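/- **Setting.** Let $1\le d<n$. $G_{d,n}$ is the Grassmannian of $d$-dimensional subspaces of $\mathbb R^n$, a subspace $S$ being identified with the orthogonal projection $\Pi_S$ onto it and the distance being the operator norm of the difference of projections. $\mathcal H^d$ is the Hausdorff measure, $\omega_d$ the volume of the unit ball of $\mathbb R^d$, $B_r(a)$ the open ball, and $A^{\eta}=\{y\in\mathbb R^n: \mathrm{dist}(y,A)<\eta\}$. For an open set $\Omega\subset\mathbb R^n$, a $d$-varifold in $\Omega$ is a non-negative Radon measure $V$ on $\Omega\times G_{d,n}$; its mass is $\|V\|(B)=V((B\cap\Omega)\times G_{d,n})$. $V$ is rectifiable, $V=v(M,\theta)$, if $M\subset\Omega$ is countably $d$-rectifiable, $\theta\ge 0$ with $\theta>0$ $\mathcal H^d$-a.e. on $M$, and $\int\varphi\,dV=\int_M\varphi(x,T_xM)\,\theta(x)\,d\mathcal H^d(x)$ for all $\varphi\in C^0_c(\Omega\times G_{d,n})$, where $T_xM$ is the approximate tangent space, which exists $\mathcal H^d$-a.e. on $M$. The first variation is $\delta V(X)=\int \mathrm{div}_S X(y)\,dV(y,S)$ for $X\in C^1_c(\Omega,\mathbb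 R^n)$; it is bounded if $|\delta V(X)|\le c\,\sup|X|$ for some constant $c$ and all such $X$. In that case $\delta V=-H\|V\|+\delta V_s$ with $H\in L^1_{loc}(\Omega,\|V\|)^n$, the generalized mean curvature, and $\delta V_s$ a vector-valued Radon measure singular with respect to $\|V\|$. For $U\subset\Omega$ open, $$\Delta^{1,1}_U(V,W)=\sup\Big\{\Big|\int\phi\,dV-\int\phi\,dW\Big| : \phi:\Omega\times G_{d,n}\to\mathbb R \text{ is 1-Lipschitz},\ |\phi|\le 1,\ \mathrm{supp}\,\phi\subset U\times G_{d,n}\Big\},$$ the supremum being over those $\phi$ for which both integrals are finite; $\Omega\times G_{d,n}$ carries the maximum of the two distances. **Kernels.** Let $\rho,\xi:\mathbb R\to[0,\infty)$ be even, supported in $[-1,1]$, with $\int_{\mathbb R^n}\rho(|w|)\,dw=\int_{\mathbb R^n}\xi(|w|)\,dw=1$, $\rho$ of class $W^{2,\infty}$ (that is, $C^1$ with Lipschitz derivative) and $\xi$ of class $W^{1,\infty}$ (that is, Lipschitz). Put $\|\rho\|_{W^{2,\infty}}=\|\rho\|_\infty+\|\rho'\|_\infty+\mathrm{lip}(\rho')$,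 $\rho_\epsilon(w)=\epsilon^{-n}\rho(|w|/\epsilon)$, $\xi_\epsilon(w)=\epsilon^{-n}\xi(|w|/\epsilon)$, $C_\rho=d\,\omega_d\int_0^1\rho(r)r^{d-1}dr$, $C_\xi=d\,\omega_d\int_0^1\xi(r)r^{d-1}dr$. The approximate mean curvature of a $d$-varifold $V$ is $$H^V_{\rho,\xi,\epsilon}(x)=-\frac{C_\xi}{C_\rho}\,\frac{\delta V*\rho_\epsilon(x)}{\|V\|*\xi_\epsilon(x)},\qquad \delta V*\rho_\epsilon(x)=\int_{\Omega\times G_{d,n}}\Pi_S\nabla\rho_\epsilon(y-x)\,dV(y,S),$$ defined whenever $\|V\|*\xi_\epsilon(x)=\int\xi_\epsilon(x-y)\,d\|V\|(y)>0$. **Theorem.** There is a constant $C>0$, depending only on $d$ and $n$, such that the following holds for every pair $(\rho,\xi)$ as above. Let $\Omega\subset\mathbb R^n$ be open, let $V=v(M,\theta)$ be a rectifiable $d$-varifold in $\Omega$ with bounded first variation, and let $(V_i)_i$ be a sequence of $d$-varifolds in $\Omega$ for which there are positive, decreasing sequences $(\eta_i)_i,(d_i)_i$ tending to $0$ such that,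 for every $i$ and every ball $B\subset\Omega$ centered in $\mathrm{supp}\,\|V\|$, $$\Delta^{1,1}_B(V,V_i)\le d_i\,\min\big(\|V\|(B^{\eta_i}),\|V_i\|(B^{\eta_i})\big).$$ Then for $\|V\|$-almost every $x\in\Omega$, for every sequence $z_i\to x$ and every positive, decreasing sequence $(\epsilon_i)_i$ tending to $0$ with $$\frac{d_i+|x-z_i|}{\epsilon_i^2}\to 0\qquad\text{and}\qquad\frac{\eta_i}{\epsilon_i}\to 0,$$ both $H^{V_i}_{\rho,\xi,\epsilon_i}(z_i)$ and $H^{V}_{\rho,\xi,\epsilon_i}(x)$ are defined (their denominators are positive) for $i$ large enough, and $$\big|H^{V_i}_{\rho,\xi,\epsilon_i}(z_i)-H^{V}_{\rho,\xi,\epsilon_i}(x)\big|\le C\,\|\rho\|_{W^{2,\infty}}\,\frac{d_i+|x-z_i|}{\epsilon_i^2}\qquad\text{for $i$ large enough},$$ $$H^{V_i}_{\rho,\xi,\epsilon_i}(z_i)\to H(x)\qquad\text{as } i\to\infty.$$ -/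

import Mathlib

open MeasureTheory Filter Topology Set
open scoped ENNReal NNReal

noncomputable section

namespace VarifoldCurvature

/-- The ambient Euclidean space `ℝⁿ`. -/
abbrev E (n : ℕ) : Type := EuclideanSpace ℝ (Fin n)

/-- The Grassmannian `G_{d,n}`: a `d`-dimensional subspace of `ℝⁿ` is identified with the orthogonal
projection onto it, and the distance is the operator norm of the difference of projections. -/
abbrev Gr (d n : ℕ) : Type :=
  {P : E n →L[ℝ] E n //
    IsStarProjection P ∧ Module.finrank ℝ (LinearMap.range (P : E n →ₗ[ℝ] E n)) = d}

/-- The subspace of `ℝⁿ` belonging to a point of the Grassmannian. -/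
def Gr.toSubmodule {d n : ℕ} (P : Gr d n) : Submodule ℝ (E n) :=
  LinearMap.range (P.1 : E n →ₗ[ℝ] E n)

/-! ### Varifolds -/

/-- A general `d`-varifold in `Ω`: a non-negative Radon measure on `Ω × G_{d,n}`, that is, a Borel
measure that is finite on compact sets. -/
structure Varifold (d n : ℕ) (Ω : Set (E n)) where
  measure : Measure (Ω × Gr d n)
  finite_of_isCompact : ∀ K : Set (Ω × Gr d n), IsCompact K → measure K < ∞

variable {d n : ℕ} {Ω : Set (E n)}

/-- The mass `‖V‖`, regarded as a Borel measure on `ℝⁿ` that is concentrated on `Ω`. -/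
def Varifold.mass (V : Varifold d n Ω) : Measure (E n) :=
  V.measure.map (fun p => (p.1 : E n))

/-! ### Rectifiable varifolds -/

/-- `M` is countably `d`-rectifiable: up to an `ℋ^d`-null set it is covered by countably many
Lipschitz images of `ℝ^d`. -/
def IsCountablyRectifiable (d n : ℕ) (M : Set (E n)) : Prop :=
  ∃ f : ℕ → E d → E n, (∀ j, ∃ K : ℝ≥0, LipschitzWith K (f j)) ∧
    (μHE[d] : Measure (E n)) (M \ ⋃ j, range (f j)) = 0

/-- The measure `θ ℋ^d` restricted to `M`. -/
def weightedHausdorff (d n : ℕ) (M : Set (E n)) (θ : E n → ℝ≥0) : Measure (E n) :=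
  ((μHE[d] : Measure (E n)).restrict M).withDensity (fun x => (θ x : ℝ≥0∞))

/-- `T` is the approximate tangent space at `x` of the set `M` with multiplicity `θ`: the blow-ups
at `x` of the measure `θ ℋ^d` on `M` converge to `θ(x) ℋ^d` on `T` against every continuous
compactly supported test function. -/
def IsApproxTangentSpace (M : Set (E n)) (θ : E n → ℝ≥0) (x : E n) (T : Gr d n) : Prop :=
  ∀ φ : E n → ℝ, Continuous φ → HasCompactSupport φ →
    Tendsto (fun r : ℝ => (r ^ d)⁻¹ * ∫ y, φ (r⁻¹ • (y - x)) ∂(weightedHausdorff d n M θ))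
      (𝓝[>] 0)
      (𝓝 ((θ x : ℝ) * ∫ w in (T.toSubmodule : Set (E n)), φ w ∂(μHE[d] : Measure (E n))))

/-- `V = v(M, θ)` is a rectifiable `d`-varifold: `M ⊆ Ω` is a countably `d`-rectifiable set, `θ` is
positive `ℋ^d`-almost everywhere in `M`, and `V` is the image of `θ ℋ^d` on `M` under the map
`x ↦ (x, T_x M)`, where `T_x M` is the approximate tangent space at `ℋ^d`-almost every `x ∈ M`. -/
def Varifold.IsRectifiable (V : Varifold d n Ω) : Prop :=
  ∃ (M : Set (E n)) (θ : E n → ℝ≥0) (T : E n → Gr d n),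
    M ⊆ Ω ∧
    NullMeasurableSet M (μHE[d] : Measure (E n)) ∧
    IsCountablyRectifiable d n M ∧
    AEMeasurable θ ((μHE[d] : Measure (E n)).restrict M) ∧
    (∀ᵐ x ∂((μHE[d] : Measure (E n)).restrict M), 0 < θ x) ∧
    AEMeasurable T ((μHE[d] : Measure (E n)).restrict M) ∧
    (∀ᵐ x ∂((μHE[d] : Measure (E n)).restrict M), IsApproxTangentSpace M θ x (T x)) ∧
    V.measure.map (fun p => ((p.1 : E n), p.2)) =
      (weightedHausdorff d n M θ).map (fun x => (x, T x))

/-! ### First variation and generalized mean curvature -/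

/-- The tangential divergence `div_P X (x) = ∑ⱼ ⟨P (∇ Xⱼ (x)), eⱼ⟩`. -/
def tangentialDiv (P : Gr d n) (X : E n → E n) (x : E n) : ℝ :=
  ∑ j : Fin n, inner ℝ (P.1 (gradient (fun y => X y j) x)) (EuclideanSpace.single j (1 : ℝ))

/-- The first variation `δV(X) = ∫ div_P X (x) dV(x, P)`. -/
def Varifold.firstVariation (V : Varifold d n Ω) (X : E n → E n) : ℝ :=
  ∫ p, tangentialDiv p.2 X (p.1 : E n) ∂V.measure

/-- `X` is a vector field of class `C¹_c(Ω, ℝⁿ)` (extended by zero). -/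
def IsTestField (Ω : Set (E n)) (X : E n → E n) : Prop :=
  ContDiff ℝ 1 X ∧ HasCompactSupport X ∧ tsupport X ⊆ Ω

/-- `V` has bounded first variation: `|δV(X)| ≤ c sup |X|` for all `X ∈ C¹_c(Ω, ℝⁿ)`. -/
def Varifold.HasBoundedFirstVariation (V : Varifold d n Ω) : Prop :=
  ∃ c : ℝ, ∀ X : E n → E n, IsTestField Ω X → |V.firstVariation X| ≤ c * ⨆ x, ‖X x‖

/-- `H` is a density in the Radon-Nikodym-Lebesgue decomposition `δV = - H ‖V‖ + δV_s`. Here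
`H ∈ L¹_loc(Ω, ‖V‖)`, and the vector-valued Radon measure `δV_s`, singular with respect to `‖V‖`,
is written in polar form `δV_s = ν σ` with its total variation `σ` and a unit vector field `ν`. -/
def Varifold.IsMeanCurvatureDensity (V : Varifold d n Ω) (H : E n → E n) : Prop :=
  LocallyIntegrableOn H Ω V.mass ∧
  ∃ (σ : Measure (E n)) (ν : E n → E n),
    σ Ωᶜ = 0 ∧ (∀ K : Set (E n), IsCompact K → K ⊆ Ω → σ K < ∞) ∧
    Measure.MutuallySingular σ V.mass ∧
    Measurable ν ∧ (∀ᵐ x ∂σ, ‖ν x‖ = 1) ∧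
    ∀ X : E n → E n, IsTestField Ω X →
      V.firstVariation X = - (∫ x, inner ℝ (X x) (H x) ∂V.mass) + ∫ x, inner ℝ (X x) (ν x) ∂σ

open scoped Classical in
/-- The generalized mean curvature vector of `V`: the density `H` of the decomposition
`δV = - H ‖V‖ + δV_s`, which exists as soon as the first variation of `V` is locally bounded and
is unique up to `‖V‖`-null sets (a representative is chosen; the value is `0` if there is none). -/
def Varifold.meanCurvature (V : Varifold d n Ω) : E n → E n :=
  if h : ∃ H : E n → E n, V.IsMeanCurvatureDensity H then h.choose else 0

/-! ### The localized bounded Lipschitz distance -/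

/-- `Δ^{1,1}_U(V, W)`: the supremum of `|∫ φ dV - ∫ φ dW|` over the `1`-Lipschitz functions `φ` on
`Ω × G_{d,n}` with `|φ| ≤ 1` and support in `U × G_{d,n}` for which both integrals are finite (they
always are when the closure of `U` is a compact subset of `Ω`). -/
def bddLipDist (U : Set (E n)) (V W : Varifold d n Ω) : ℝ≥0∞ :=
  ⨆ φ ∈ {φ : Ω × Gr d n → ℝ | LipschitzWith 1 φ ∧ (∀ p, |φ p| ≤ 1) ∧
      tsupport φ ⊆ {p | (p.1 : E n) ∈ U} ∧
      Integrable φ V.measure ∧ Integrable φ W.measure},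
    ENNReal.ofReal |(∫ p, φ p ∂V.measure) - ∫ p, φ p ∂W.measure|

/-! ### Kernel profiles -/

/-- A kernel profile on `ℝⁿ`: a non-negative, even, continuous function on `ℝ`, supported in
`[-1, 1]`, such that `∫ f(|w|) dw = 1` over `ℝⁿ`. -/
structure IsKernelProfile (n : ℕ) (f : ℝ → ℝ) : Prop where
  nonneg : ∀ t, 0 ≤ f t
  even : ∀ t, f (-t) = f t
  continuous : Continuous f
  support_subset : Function.support f ⊆ Icc (-1) 1
  integral_eq_one : ∫ w : E n, f ‖w‖ = 1

/-- The assumption on the pair `(ρ, ξ)`: both are kernel profiles, `ρ` is of class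
`W^{2,∞} = C^{1,1}` and `ξ` is of class `W^{1,∞} = C^{0,1}`. -/
structure IsRegularKernelPair (n : ℕ) (ρ ξ : ℝ → ℝ) : Prop where
  profile_left : IsKernelProfile n ρ
  profile_right : IsKernelProfile n ξ
  contDiff_left : ContDiff ℝ 1 ρ
  lipschitz_deriv_left : ∃ K : ℝ≥0, LipschitzWith K (deriv ρ)
  lipschitz_right : ∃ K : ℝ≥0, LipschitzWith K ξ

/-- The supremum norm on `ℝ` (of a bounded function). -/
def supNorm (u : ℝ → ℝ) : ℝ := ⨆ t, |u t|

/-- The least Lipschitz constant (of a Lipschitz function). -/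
def lipConst (u : ℝ → ℝ) : ℝ := sInf {K : ℝ | 0 ≤ K ∧ ∀ s t, |u s - u t| ≤ K * |s - t|}

/-- The norm `‖u‖_∞ + ‖u'‖_∞ + lip(u')` of `W^{2,∞}(ℝ)`. -/
def normW2 (u : ℝ → ℝ) : ℝ := supNorm u + (supNorm (deriv u) + lipConst (deriv u))

/-- The rescaled radial kernel `f_ε(w) = ε^{-n} f(|w/ε|)` on `ℝⁿ`. -/
def scaledKernel (n : ℕ) (f : ℝ → ℝ) (ε : ℝ) (w : E n) : ℝ := (ε ^ n)⁻¹ * f ‖ε⁻¹ • w‖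

/-- The constant `C_f = d ω_d ∫₀¹ f(r) r^{d-1} dr`, where `ω_d` is the volume of the unit ball
of `ℝ^d`. -/
def kernelConst (d : ℕ) (f : ℝ → ℝ) : ℝ :=
  d * (volume : Measure (E d)).real (Metric.ball 0 1) * ∫ r in (0 : ℝ)..1, f r * r ^ (d - 1)

/-! ### Approximate mean curvature -/

/-- The regularized first variation `δV ∗ ρ_ε (x) = ∫ ∇^S ρ_ε (y - x) dV(y, S)`, where `∇^S` is
the projection of the gradient onto `S`. -/
def Varifold.regFirstVariation (V : Varifold d n Ω) (ρ : ℝ → ℝ) (ε : ℝ) (x : E n) : E n :=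
  ∫ p, p.2.1 (gradient (scaledKernel n ρ ε) ((p.1 : E n) - x)) ∂V.measure

/-- The regularized mass `‖V‖ ∗ ξ_ε (x) = ∫ ξ_ε (x - y) d‖V‖(y)`. -/
def Varifold.regMass (V : Varifold d n Ω) (ξ : ℝ → ℝ) (ε : ℝ) (x : E n) : ℝ :=
  ∫ y, scaledKernel n ξ ε (x - y) ∂V.mass

/-- The approximate mean curvature
`H^V_{ρ,ξ,ε}(x) = - (C_ξ / C_ρ) (δV ∗ ρ_ε (x)) / (‖V‖ ∗ ξ_ε (x))`
(meaningful when `‖V‖ ∗ ξ_ε (x) > 0`). -/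
def Varifold.approxMeanCurvature (V : Varifold d n Ω) (ρ ξ : ℝ → ℝ) (ε : ℝ) (x : E n) : E n :=
  -((kernelConst d ξ / kernelConst d ρ) • ((V.regMass ξ ε x)⁻¹ • V.regFirstVariation ρ ε x))

end VarifoldCurvature

end

noncomputable section

namespace VarifoldCurvature

open scoped BoundedContinuousFunction CompactlySupported

variable {d n : ℕ} {Ω : Set (E n)}

/-! ### The Grassmannian is compact -/

/-! Two facts combine: convergence for the fixed varifold `V`, and stability of the quotient under
perturbation of the varifold and of the base point.

For `‖V‖`-almost every `x`, the blow-ups of `‖V‖` at `x` converge against radial functions to `θ`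
times Lebesgue measure on `ℝ^d`, with `θ > 0`; moreover `x` is a Lebesgue point of `H`, and the
singular part of `δV` has density zero there. Hence `ε^(n-d) ‖V‖ * ξ_ε(x) → θ C_ξ`
(`Varifold.tendsto_regMass`). Testing `δV` with `ρ_ε(· - x) e` gives `ε^(n-d) δV * ρ_ε(x) → -θ C_ρ
H(x)` (`Varifold.tendsto_regFirstVariation`), so the quotient tends to `H(x)`. That `H` exists at
all is proved by Hahn–Banach, a total variation measure, Riesz representation in `L²` and Lebesgue
decomposition.

For stability, numerator and denominator are integrals of kernels whose Lipschitz constants have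
order `ε^(-n-2)` and `ε^(-n-1)`. Passing from `V_i` to `V` costs `d_i`, by the bounded Lipschitz
hypothesis; moving `z_i` to `x` costs `|x - z_i|`; both are multiplied by the mass of a ball of
radius `4ε`, which is of order `θ ε^d` (`Varifold.abs_integral_sub_le`). The denominator error is
better by one power of `ε`, so its contribution to the quotient is eventually absorbed by the
summand `1` in `C`. In the main term `θ` and `C_ξ` cancel, and `C_ρ` is bounded below in terms of
`d` and `n` alone (`kernelLowerBound_le`), because `ρ` is normalized in `ℝⁿ`. -/

/-- The rank of a projection is its trace, which is continuous in `P`; this turns the Grassmannian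
into a closed set of operators. -/
lemma isStarProjection_finrank_iff (P : E n →L[ℝ] E n) :
    (IsStarProjection P ∧ Module.finrank ℝ (LinearMap.range (P : E n →ₗ[ℝ] E n)) = d) ↔
      (P * P = P ∧ star P = P) ∧ LinearMap.trace ℝ (E n) (P : E n →ₗ[ℝ] E n) = d := by
  have key : P * P = P → LinearMap.trace ℝ (E n) (P : E n →ₗ[ℝ] E n) =
      Module.finrank ℝ (LinearMap.range (P : E n →ₗ[ℝ] E n)) := fun h => by
    refine (LinearMap.IsIdempotentElem.isProj_range (P : E n →ₗ[ℝ] E n) ?_).trace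
    ext1 x
    exact DFunLike.congr_fun h x
  constructor
  · rintro ⟨h, h2⟩
    exact ⟨⟨h.isIdempotentElem, h.isSelfAdjoint⟩, by rw [key h.isIdempotentElem, h2]⟩
  · rintro ⟨⟨h1, h2⟩, h3⟩
    rw [key h1] at h3
    exact ⟨⟨h1, h2⟩, by exact_mod_cast h3⟩

/-- Compactness makes `K × G_{d,n}` compact for compact `K ⊆ Ω`, so that the mass is finite on such
`K`. -/
instance : CompactSpace (Gr d n) := by
  refine isCompact_iff_compactSpace.1 (Metric.isCompact_of_isClosed_isBounded
    (s := {P : E n →L[ℝ] E n | IsStarProjection P ∧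
      Module.finrank ℝ (LinearMap.range (P : E n →ₗ[ℝ] E n)) = d}) ?_ ?_)
  · simp_rw [isStarProjection_finrank_iff]
    refine IsClosed.inter (IsClosed.inter (isClosed_eq (by fun_prop) continuous_id)
      (isClosed_eq (ContinuousLinearMap.adjoint (𝕜 := ℝ) (E := E n) (F := E n)).continuous continuous_id)) (isClosed_eq ?_ continuous_const)
    exact (LinearMap.continuous_of_finiteDimensional
      ((LinearMap.trace ℝ (E n)) ∘ₗ (ContinuousLinearMap.coeLM ℝ)))
  · refine (Metric.isBounded_closedBall (x := 0) (r := 1)).subset fun P hP => ?_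
    simpa using IsStarProjection.norm_le P hP.1

lemma Gr.norm_apply_le (P : Gr d n) (v : E n) : ‖P.1 v‖ ≤ ‖v‖ :=
  (P.1.le_of_opNorm_le (IsStarProjection.norm_le P.1 P.2.1) v).trans_eq (one_mul _)

/-! ### Integration against a varifold -/

instance (V : Varifold d n Ω) : IsFiniteMeasureOnCompacts V.measure :=
  ⟨fun {K} hK => V.finite_of_isCompact K hK⟩

lemma isCompact_preimage_fst {K : Set (E n)} (hK : IsCompact K) (hKΩ : K ⊆ Ω) :
    IsCompact {p : Ω × Gr d n | (p.1 : E n) ∈ K} := by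
  have h1 : IsCompact ((↑) ⁻¹' K : Set Ω) := by
    rw [Subtype.isCompact_iff, Subtype.image_preimage_coe, inter_eq_right.2 hKΩ]
    exact hK
  convert! h1.prod (isCompact_univ (X := Gr d n)) using 1
  ext p
  simp

lemma Varifold.integrable_of_continuous (V : Varifold d n Ω) {F : Type*} [NormedAddCommGroup F]
    {φ : Ω × Gr d n → F} (hφ : Continuous φ) {K : Set (E n)} (hK : IsCompact K) (hKΩ : K ⊆ Ω)
    (h0 : ∀ p, (p.1 : E n) ∉ K → φ p = 0) : Integrable φ V.measure :=
  hφ.integrable_of_hasCompactSupport (HasCompactSupport.intro (isCompact_preimage_fst hK hKΩ) h0)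

lemma measurable_coe_fst : Measurable (fun p : Ω × Gr d n => (p.1 : E n)) :=
  measurable_subtype_coe.comp measurable_fst

lemma Varifold.mass_apply (V : Varifold d n Ω) {s : Set (E n)} (hs : MeasurableSet s) :
    V.mass s = V.measure {p | (p.1 : E n) ∈ s} :=
  Measure.map_apply measurable_coe_fst hs

lemma Varifold.mass_lt_top (V : Varifold d n Ω) {K : Set (E n)} (hK : IsCompact K) (hKΩ : K ⊆ Ω) :
    V.mass K < ∞ := by
  rw [V.mass_apply hK.measurableSet]
  exact V.finite_of_isCompact _ (isCompact_preimage_fst hK hKΩ)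

lemma Varifold.mass_compl (V : Varifold d n Ω) (hΩ : IsOpen Ω) : V.mass Ωᶜ = 0 := by
  rw [V.mass_apply hΩ.measurableSet.compl]
  convert measure_empty (μ := V.measure)
  ext p
  simp

lemma Varifold.integral_mass (V : Varifold d n Ω) {f : E n → ℝ} (hf : Continuous f) :
    ∫ y, f y ∂V.mass = ∫ p, f (p.1 : E n) ∂V.measure :=
  integral_map measurable_coe_fst.aemeasurable hf.aestronglyMeasurable

lemma Varifold.integrable_mass (V : Varifold d n Ω) {F : Type*} [NormedAddCommGroup F]
    {f : E n → F} (hf : Continuous f) {K : Set (E n)} (hK : IsCompact K) (hKΩ : K ⊆ Ω)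
    (h0 : ∀ y, y ∉ K → f y = 0) : Integrable f V.mass := by
  refine (integrable_map_measure hf.aestronglyMeasurable measurable_coe_fst.aemeasurable).2 ?_
  exact V.integrable_of_continuous
    (hf.comp (continuous_subtype_val.comp continuous_fst)) hK hKΩ fun p hp => h0 _ hp

/-! ### Radial functions -/

/-- The gradient of `w ↦ ρ ‖w‖`. -/
def radialGrad (ρ : ℝ → ℝ) (w : E n) : E n := (deriv ρ ‖w‖ / ‖w‖) • w

lemma deriv_zero_of_even {ρ : ℝ → ℝ} (h : ∀ t, ρ (-t) = ρ t) : deriv ρ 0 = 0 := by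
  have h1 : deriv (fun t => ρ (-t)) 0 = -deriv ρ (-0) := deriv_comp_neg ρ 0
  simp only [h, neg_zero] at h1
  have : deriv ρ 0 = -deriv ρ 0 := h1
  linarith

lemma norm_radialGrad {ρ : ℝ → ℝ} (h : ∀ t, ρ (-t) = ρ t) (w : E n) :
    ‖radialGrad ρ w‖ = |deriv ρ ‖w‖| := by
  rcases eq_or_ne w 0 with rfl | hw
  · simp [radialGrad, deriv_zero_of_even h]
  · have : ‖w‖ ≠ 0 := norm_ne_zero_iff.2 hw
    rw [radialGrad, norm_smul, Real.norm_eq_abs, abs_div, abs_norm, div_mul_cancel₀ _ this]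

/-- Evenness handles the origin: `ρ'(0) = 0`, so the value `0` that `radialGrad` takes there is the
true gradient. -/
lemma hasGradientAt_radial {ρ : ℝ → ℝ} (h : ∀ t, ρ (-t) = ρ t) (hd : Differentiable ℝ ρ)
    (w : E n) : HasGradientAt (fun w : E n => ρ ‖w‖) (radialGrad ρ w) w := by
  rcases eq_or_ne w 0 with rfl | hw
  · have h1 : HasDerivAt ρ 0 0 := by
      simpa [deriv_zero_of_even h] using (hd 0).hasDerivAt
    rw [hasGradientAt_iff_isLittleO]
    rw [hasDerivAt_iff_isLittleO_nhds_zero] at h1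
    have h2 : Tendsto (fun w : E n => ‖w‖) (𝓝 0) (𝓝 0) := by
      simpa using (continuous_norm (E := E n)).tendsto 0
    have h3 := (h1.comp_tendsto h2).norm_right
    simp only [Function.comp_def, norm_norm, smul_zero, sub_zero, zero_add] at h3
    simpa [radialGrad] using h3.of_norm_right
  · have hw' : ‖w‖ ≠ 0 := norm_ne_zero_iff.2 hw
    have h1 : HasFDerivAt (fun w : E n => ‖w‖) (‖w‖⁻¹ • innerSL ℝ w) w := by
      have h2 := ((hasStrictFDerivAt_norm_sq w).hasFDerivAt).sqrt (by positivity)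
      simp only [Real.sqrt_sq (norm_nonneg _)] at h2
      convert! h2 using 1
      ext v
      simp
      field_simp
    have h2 := (hd ‖w‖).hasDerivAt.comp_hasFDerivAt w h1
    rw [hasGradientAt_iff_hasFDerivAt]
    convert! h2 using 1
    ext v
    simp [radialGrad]
    ring

/-- The constant is `K + 2K`: changing the modulus `ρ'(|a|)` costs `K`, and changing the direction
costs `2K`, since `|b|` times the difference of the unit vectors has norm at most `2|a - b|`, while
`|ρ'(|b|)| ≤ K|b|` because `ρ'(0) = 0`. -/
lemma norm_radialGrad_sub_le {ρ : ℝ → ℝ} (h : ∀ t, ρ (-t) = ρ t) {K : ℝ}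
    (hK : ∀ s t, |deriv ρ s - deriv ρ t| ≤ K * |s - t|) (a b : E n) :
    ‖radialGrad ρ a - radialGrad ρ b‖ ≤ 3 * K * ‖a - b‖ := by
  have h0 := deriv_zero_of_even h
  have hK0 : 0 ≤ K := by simpa using (abs_nonneg _).trans (hK 0 1)
  have hb : ∀ t, |deriv ρ t| ≤ K * |t| := fun t => by simpa [h0] using hK t 0
  rcases eq_or_ne a 0 with rfl | ha
  · have h1 := hb ‖b‖
    have h2 : radialGrad ρ (0 : E n) = 0 := by simp [radialGrad]
    rw [h2, zero_sub, norm_neg, norm_radialGrad h, zero_sub, norm_neg]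
    rw [abs_norm] at h1
    nlinarith [norm_nonneg b, mul_nonneg hK0 (norm_nonneg b)]
  rcases eq_or_ne b 0 with rfl | hb'
  · have h1 := hb ‖a‖
    have h2 : radialGrad ρ (0 : E n) = 0 := by simp [radialGrad]
    rw [h2, sub_zero, norm_radialGrad h, sub_zero]
    rw [abs_norm] at h1
    nlinarith [norm_nonneg a, mul_nonneg hK0 (norm_nonneg a)]
  have ha0 : ‖a‖ ≠ 0 := norm_ne_zero_iff.2 ha
  have hb0 : ‖b‖ ≠ 0 := norm_ne_zero_iff.2 hb'
  set f := deriv ρ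
  have e : radialGrad ρ a - radialGrad ρ b = (f ‖a‖ - f ‖b‖) • (‖a‖⁻¹ • a)
      + (f ‖b‖ / ‖b‖) • (((‖b‖ - ‖a‖) • (‖a‖⁻¹ • a)) + (a - b)) := by
    simp only [radialGrad]
    have h3 : a = ‖a‖ • (‖a‖⁻¹ • a) := by rw [smul_smul, mul_inv_cancel₀ ha0, one_smul]
    have h4 : (f ‖a‖ / ‖a‖) • a = f ‖a‖ • (‖a‖⁻¹ • a) := by rw [smul_smul]; rfl
    have h5 : (‖b‖ - ‖a‖) • (‖a‖⁻¹ • a) + (a - b) = ‖b‖ • (‖a‖⁻¹ • a) - b := by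
      conv_lhs => rw [sub_smul, ← h3]
      abel
    rw [h4, h5, smul_sub, smul_smul (f ‖b‖ / ‖b‖), div_mul_cancel₀ _ hb0, sub_smul]
    abel
  have hu : ‖‖a‖⁻¹ • a‖ = 1 := by
    rw [norm_smul, norm_inv, norm_norm, inv_mul_cancel₀ ha0]
  have h6 : |‖a‖ - ‖b‖| ≤ ‖a - b‖ := abs_norm_sub_norm_le a b
  have h7 : |f ‖b‖ / ‖b‖| ≤ K := by
    rw [abs_div, abs_norm, div_le_iff₀ (by positivity)]
    simpa using hb ‖b‖
  calc ‖radialGrad ρ a - radialGrad ρ b‖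
      ≤ |f ‖a‖ - f ‖b‖| * 1 + |f ‖b‖ / ‖b‖| * (|‖b‖ - ‖a‖| * 1 + ‖a - b‖) := by
        rw [e]
        refine (norm_add_le _ _).trans (add_le_add ?_ ?_)
        · rw [norm_smul, hu, Real.norm_eq_abs]
        · rw [norm_smul, Real.norm_eq_abs]
          gcongr
          refine (norm_add_le _ _).trans (add_le_add ?_ le_rfl)
          rw [norm_smul, hu, Real.norm_eq_abs]
    _ ≤ K * ‖a - b‖ * 1 + K * (‖a - b‖ * 1 + ‖a - b‖) := by
        gcongr
        · exact (hK _ _).trans (by gcongr)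
        · rwa [abs_sub_comm]
    _ = 3 * K * ‖a - b‖ := by ring

lemma continuous_radialGrad {ρ : ℝ → ℝ} (h : ∀ t, ρ (-t) = ρ t) {K : ℝ}
    (hK : ∀ s t, |deriv ρ s - deriv ρ t| ≤ K * |s - t|) :
    Continuous (radialGrad ρ : E n → E n) :=
  (LipschitzWith.of_dist_le' fun a b => by
    rw [dist_eq_norm, dist_eq_norm]
    exact norm_radialGrad_sub_le h hK a b).continuous

lemma hasGradientAt_scaledKernel {ρ : ℝ → ℝ} (h : ∀ t, ρ (-t) = ρ t) (hd : Differentiable ℝ ρ)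
    (ε : ℝ) (w : E n) :
    HasGradientAt (scaledKernel n ρ ε) (((ε ^ n)⁻¹ * ε⁻¹) • radialGrad ρ (ε⁻¹ • w)) w := by
  have h1 := (hasGradientAt_radial h hd (ε⁻¹ • w)).hasFDerivAt
  have h2 : HasFDerivAt (fun w : E n => ε⁻¹ • w) (ε⁻¹ • ContinuousLinearMap.id ℝ (E n)) w :=
    (hasFDerivAt_id (𝕜 := ℝ) w).fun_const_smul ε⁻¹
  have h3 := (h1.comp w h2).const_mul (ε ^ n)⁻¹
  rw [hasGradientAt_iff_hasFDerivAt]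
  convert! h3 using 1
  ext v
  simp
  ring

/-! ### Kernel profiles -/

lemma IsKernelProfile.eq_zero {f : ℝ → ℝ} (h : IsKernelProfile n f) {t : ℝ} (ht : 1 < |t|) :
    f t = 0 := by
  by_contra hne
  have := h.support_subset hne
  rw [mem_Icc, ← abs_le] at this
  linarith

lemma IsKernelProfile.hasCompactSupport {f : ℝ → ℝ} (h : IsKernelProfile n f) :
    HasCompactSupport f :=
  HasCompactSupport.intro (isCompact_Icc (a := (-1 : ℝ)) (b := 1)) fun t ht => by
    by_contra hne
    exact ht (h.support_subset hne)

lemma abs_le_supNorm {u : ℝ → ℝ} (hu : Continuous u) (hc : HasCompactSupport u) (t : ℝ) :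
    |u t| ≤ supNorm u := by
  obtain ⟨C, hC⟩ := hu.bounded_above_of_compact_support hc
  exact le_ciSup (f := fun t => |u t|) ⟨C, by rintro _ ⟨t, rfl⟩; exact hC t⟩ t

lemma abs_sub_le_lipConst {u : ℝ → ℝ} {K : ℝ≥0} (hK : LipschitzWith K u) (s t : ℝ) :
    |u s - u t| ≤ lipConst u * |s - t| := by
  rcases eq_or_ne s t with rfl | hst
  · simp
  have h0 : 0 < |s - t| := abs_pos.2 (sub_ne_zero.2 hst)
  rw [← div_le_iff₀ h0]
  refine le_csInf ⟨K, K.2, fun s t => by simpa [Real.dist_eq] using hK.dist_le_mul s t⟩ ?_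
  rintro L ⟨-, hL⟩
  rw [div_le_iff₀ h0]
  exact hL s t

lemma lipConst_nonneg (u : ℝ → ℝ) : 0 ≤ lipConst u := Real.sInf_nonneg fun _ h => h.1

lemma supNorm_nonneg (u : ℝ → ℝ) : 0 ≤ supNorm u := Real.iSup_nonneg fun _ => abs_nonneg _

lemma normW2_pos {ρ : ℝ → ℝ} (h : IsKernelProfile n ρ) : 0 < normW2 ρ := by
  have h1 : ∃ t, ρ t ≠ 0 := by
    by_contra! hall
    have := h.integral_eq_one
    simp [hall] at this
  obtain ⟨t, ht⟩ := h1
  have h2 := abs_le_supNorm h.continuous h.hasCompactSupport t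
  have h3 := supNorm_nonneg (deriv ρ)
  have h4 := lipConst_nonneg (deriv ρ)
  have := abs_pos.2 ht
  unfold normW2
  linarith

lemma abs_deriv_le_normW2 {ρ : ℝ → ℝ} (h : IsKernelProfile n ρ) (h1 : ContDiff ℝ 1 ρ) (t : ℝ) :
    |deriv ρ t| ≤ normW2 ρ := by
  have h2 := abs_le_supNorm (h1.continuous_deriv le_rfl) h.hasCompactSupport.deriv t
  have h3 := supNorm_nonneg ρ
  have h4 := lipConst_nonneg (deriv ρ)
  unfold normW2
  linarith

lemma abs_deriv_sub_le_normW2 {ρ : ℝ → ℝ} {K : ℝ≥0} (hK : LipschitzWith K (deriv ρ)) (s t : ℝ) :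
    |deriv ρ s - deriv ρ t| ≤ normW2 ρ * |s - t| := by
  refine (abs_sub_le_lipConst hK s t).trans ?_
  gcongr
  have h3 := supNorm_nonneg ρ
  have h4 := supNorm_nonneg (deriv ρ)
  unfold normW2
  linarith

/-! ### Radial integrals -/

/-- A linear isometry of `ℝ^d` onto the subspace preserves norms and carries Lebesgue measure to
Hausdorff measure. Radial tests therefore do not see which tangent plane occurs. -/
lemma integral_radial_subspace (T : Gr d n) (f : ℝ → ℝ) :
    ∫ w in (T.toSubmodule : Set (E n)), f ‖w‖ ∂(μHE[d] : Measure (E n)) = ∫ w : E d, f ‖w‖ := by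
  have hT : Module.finrank ℝ T.toSubmodule = d := T.2.2
  let b := (stdOrthonormalBasis ℝ T.toSubmodule).reindex (finCongr hT)
  let ι : E d →ₗᵢ[ℝ] E n := T.toSubmodule.subtypeₗᵢ.comp b.repr.symm.toLinearIsometry
  have hr : range ι = (T.toSubmodule : Set (E n)) := by
    change range (Subtype.val ∘ b.repr.symm) = _
    rw [range_comp, b.repr.symm.surjective.range_eq, image_univ, Subtype.range_coe]
  rw [← hr, ← ι.isometry.map_euclideanHausdorffMeasure,
    EuclideanSpace.euclideanHausdorffMeasure_eq_volume,
    ι.isometry.isClosedEmbedding.measurableEmbedding.integral_map]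
  simp

lemma IsKernelProfile.integral_Ioi {f : ℝ → ℝ} (h : IsKernelProfile n f) (g : ℝ → ℝ) :
    ∫ y in Ioi (0 : ℝ), g y * f y = ∫ y in (0 : ℝ)..1, f y * g y := by
  rw [intervalIntegral.integral_of_le zero_le_one, ← Ioc_union_Ioi_eq_Ioi zero_le_one,
    ← integral_indicator (measurableSet_Ioc.union measurableSet_Ioi),
    ← integral_indicator measurableSet_Ioc]
  congr 1
  ext y
  by_cases hy : y ∈ Ioc (0 : ℝ) 1
  · rw [indicator_of_mem hy, indicator_of_mem (mem_union_left _ hy), mul_comm]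
  · rw [indicator_of_notMem hy]
    by_cases hy' : y ∈ Ioi (1 : ℝ)
    · rw [indicator_of_mem (mem_union_right _ hy'), h.eq_zero (lt_of_lt_of_le hy' (le_abs_self y)), mul_zero]
    · rw [indicator_of_notMem (by rintro (h | h) <;> contradiction)]

lemma IsKernelProfile.integral_radial {f : ℝ → ℝ} (h : IsKernelProfile n f) (hd : 1 ≤ d) :
    ∫ w : E d, f ‖w‖ = kernelConst d f := by
  have : Nontrivial (E d) :=
    Module.nontrivial_of_finrank_pos (R := ℝ) (by rw [finrank_euclideanSpace_fin]; lia)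
  rw [integral_fun_norm_addHaar, finrank_euclideanSpace_fin, kernelConst]
  simp only [smul_eq_mul, nsmul_eq_mul]
  rw [h.integral_Ioi, mul_assoc]

/-- A lower bound for the constants `C_ρ` that depends on the dimensions only. -/
def kernelLowerBound (d n : ℕ) : ℝ :=
  d * (volume : Measure (E d)).real (Metric.ball 0 1) /
    (n * (volume : Measure (E n)).real (Metric.ball 0 1))

lemma volume_real_ball_pos (d : ℕ) : 0 < (volume : Measure (E d)).real (Metric.ball 0 1) :=
  ENNReal.toReal_pos (Metric.measure_ball_pos _ _ one_pos).ne' measure_ball_lt_top.ne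

lemma kernelLowerBound_pos (hd : 1 ≤ d) (hdn : d < n) : 0 < kernelLowerBound d n := by
  have h1 : (0 : ℝ) < d := by exact_mod_cast hd
  have h2 : (0 : ℝ) < n := by exact_mod_cast (hd.trans hdn.le)
  have := volume_real_ball_pos d
  have := volume_real_ball_pos n
  unfold kernelLowerBound
  positivity

/-- The normalization says that the constant in dimension `n` equals `1`; on `[0, 1]` one has
`r^(n-1) ≤ r^(d-1)`, so the radial integral only grows when `n` is replaced by `d`. -/
lemma kernelLowerBound_le {f : ℝ → ℝ} (h : IsKernelProfile n f) (hd : 1 ≤ d) (hdn : d < n) :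
    kernelLowerBound d n ≤ kernelConst d f := by
  have h1 : kernelConst n f = 1 := by
    rw [← h.integral_radial (hd.trans hdn.le), h.integral_eq_one]
  have h2 : (0 : ℝ) < n := by exact_mod_cast (hd.trans hdn.le)
  have h3 := volume_real_ball_pos d
  have h4 := volume_real_ball_pos n
  have hc := h.continuous
  have h5 : ∫ r in (0 : ℝ)..1, f r * r ^ (n - 1) ≤ ∫ r in (0 : ℝ)..1, f r * r ^ (d - 1) := by
    refine intervalIntegral.integral_mono_on zero_le_one
      (Continuous.intervalIntegrable (by fun_prop) _ _)
      (Continuous.intervalIntegrable (by fun_prop) _ _) fun r hr => ?_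
    exact mul_le_mul_of_nonneg_left (pow_le_pow_of_le_one hr.1 hr.2 (by lia)) (h.nonneg r)
  rw [kernelConst] at h1
  have h6 : ∫ r in (0 : ℝ)..1, f r * r ^ (n - 1) =
      1 / (n * (volume : Measure (E n)).real (Metric.ball 0 1)) := by
    rw [eq_div_iff (by positivity)]
    linarith
  rw [h6] at h5
  rw [kernelConst, kernelLowerBound, div_eq_mul_one_div]
  gcongr

/-! ### Blow-ups of the mass of a rectifiable varifold -/

/-- The blow-ups of `m` at `x` converge, against radial functions, to `θ` times the Lebesgue measure
of a `d`-dimensional space. -/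
def HasRadialBlowup (m : Measure (E n)) (d : ℕ) (x : E n) (θ : ℝ) : Prop :=
  ∀ f : ℝ → ℝ, Continuous f → HasCompactSupport f →
    Tendsto (fun r : ℝ => (r ^ d)⁻¹ * ∫ y, f ‖r⁻¹ • (y - x)‖ ∂m) (𝓝[>] 0)
      (𝓝 (θ * ∫ w : E d, f ‖w‖))

lemma Varifold.IsRectifiable.ae_hasRadialBlowup {V : Varifold d n Ω} (hV : V.IsRectifiable) :
    ∀ᵐ x ∂V.mass, ∃ θ : ℝ, 0 < θ ∧ HasRadialBlowup V.mass d x θ := by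
  obtain ⟨M, θ, T, -, -, -, -, hpos, hT, htan, hmap⟩ := hV
  have hac : weightedHausdorff d n M θ ≪ (μHE[d] : Measure (E n)).restrict M :=
    withDensity_absolutelyContinuous _ _
  have hmass : V.mass = weightedHausdorff d n M θ := by
    -- Projecting away the Grassmannian component identifies the mass with `θ ℋ^d` on `M`.
    have h1 := congrArg (Measure.map Prod.fst) hmap
    rw [Measure.map_map measurable_fst (measurable_coe_fst.prodMk measurable_snd),
      AEMeasurable.map_map_of_aemeasurable measurable_fst.aemeasurable
        (aemeasurable_id'.prodMk (hT.mono_ac hac))] at h1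
    calc V.mass = _ := h1
      _ = (weightedHausdorff d n M θ).map id := rfl
      _ = _ := Measure.map_id
  rw [hmass]
  filter_upwards [hac.ae_le hpos, hac.ae_le htan] with x hx1 hx2
  refine ⟨θ x, hx1, fun f hf hfc => ?_⟩
  rw [← integral_radial_subspace (T x) f]
  refine hx2 (fun w => f ‖w‖) (by fun_prop) ?_
  obtain ⟨R, hR⟩ := hfc.isCompact.isBounded.subset_closedBall 0
  refine HasCompactSupport.intro (isCompact_closedBall (0 : E n) R) fun w hw => ?_
  by_contra hne
  have := hR (subset_tsupport f hne)
  simp at this hw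
  linarith

/-! ### The total variation measure of a functional on vector fields -/

section TotalVariation

variable {X F : Type*} [TopologicalSpace X] [NormedAddCommGroup F] [NormedSpace ℝ F]

/-- The values of a functional at the vector fields that are pointwise dominated by `f`. -/
def dominatedValues (L : StrongDual ℝ (X →ᵇ F)) (f : C_c(X, ℝ≥0)) : Set ℝ :=
  {t | ∃ Y : X →ᵇ F, (∀ x, ‖Y x‖ ≤ f x) ∧ L Y = t}

variable (L : StrongDual ℝ (X →ᵇ F))

lemma zero_mem_dominatedValues (f : C_c(X, ℝ≥0)) : 0 ∈ dominatedValues L f :=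
  ⟨0, fun x => by simp, map_zero L⟩

lemma le_of_mem_dominatedValues {f : C_c(X, ℝ≥0)} {C : ℝ} (hC : 0 ≤ C) (hf : ∀ x, (f x : ℝ) ≤ C)
    {t : ℝ} (ht : t ∈ dominatedValues L f) : t ≤ ‖L‖ * C := by
  obtain ⟨Y, hY, rfl⟩ := ht
  refine (le_abs_self _).trans ((L.le_opNorm Y).trans ?_)
  gcongr
  exact (BoundedContinuousFunction.norm_le hC).2 fun x => (hY x).trans (hf x)

lemma bddAbove_dominatedValues (f : C_c(X, ℝ≥0)) : BddAbove (dominatedValues L f) := by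
  have h1 : Continuous fun x => (f x : ℝ) := by fun_prop
  obtain ⟨C, hC⟩ := h1.bounded_above_of_compact_support (f.hasCompactSupport.comp_left (by simp))
  refine ⟨‖L‖ * max C 0, fun t ht => le_of_mem_dominatedValues L (le_max_right _ _) (fun x => ?_) ht⟩
  exact (le_abs_self _).trans ((hC x).trans (le_max_left _ _))

/-- The total variation of a functional, evaluated at a nonnegative function. -/
def totalVariation (f : C_c(X, ℝ≥0)) : ℝ≥0 :=
  ⟨sSup (dominatedValues L f),
    le_csSup (bddAbove_dominatedValues L f) (zero_mem_dominatedValues L f)⟩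

variable {L}

lemma apply_le_totalVariation {f : C_c(X, ℝ≥0)} {Y : X →ᵇ F} (hY : ∀ x, ‖Y x‖ ≤ f x) :
    L Y ≤ totalVariation L f :=
  le_csSup (bddAbove_dominatedValues L f) ⟨Y, hY, rfl⟩

lemma totalVariation_le {f : C_c(X, ℝ≥0)} {C : ℝ}
    (h : ∀ Y : X →ᵇ F, (∀ x, ‖Y x‖ ≤ f x) → L Y ≤ C) : (totalVariation L f : ℝ) ≤ C :=
  csSup_le ⟨0, zero_mem_dominatedValues L f⟩ (by rintro _ ⟨Y, hY, rfl⟩; exact h Y hY)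

/-- The coefficient may jump where `f + g = 0`, but it stays in `[0, 1]` and `Y` vanishes there, so
the product is still continuous. -/
lemma continuous_proportion {f g : X → ℝ} (hf : Continuous f) (hg : Continuous g)
    (hf0 : ∀ x, 0 ≤ f x) (hg0 : ∀ x, 0 ≤ g x) {Y : X → F} (hY : Continuous Y)
    (h : ∀ x, ‖Y x‖ ≤ f x + g x) : Continuous fun x => (f x / (f x + g x)) • Y x := by
  refine continuous_iff_continuousAt.2 fun x => ?_
  by_cases hx : f x + g x = 0
  · have hYx : Y x = 0 := norm_le_zero_iff.1 (hx ▸ h x)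
    rw [ContinuousAt, hYx, smul_zero]
    refine squeeze_zero_norm (a := fun y => ‖Y y‖) (fun y => ?_) ?_
    · rw [norm_smul, Real.norm_eq_abs, abs_of_nonneg (div_nonneg (hf0 y) (add_nonneg (hf0 y) (hg0 y)))]
      refine mul_le_of_le_one_left (norm_nonneg _) (div_le_one_of_le₀ ?_ ?_)
      · linarith [hg0 y]
      · linarith [hg0 y, hf0 y]
    · simpa [hYx] using hY.norm.tendsto x
  · exact (hf.continuousAt.div (hf.add hg).continuousAt hx).smul hY.continuousAt

lemma norm_proportion_le {a b : ℝ} (ha : 0 ≤ a) (hb : 0 ≤ b) {y : F} (h : ‖y‖ ≤ a + b) :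
    ‖(a / (a + b)) • y‖ ≤ a := by
  rw [norm_smul, Real.norm_eq_abs, abs_of_nonneg (by positivity)]
  rcases (add_nonneg ha hb).eq_or_lt with h0 | h0
  · simp [← h0, ha]
  · calc a / (a + b) * ‖y‖ ≤ a / (a + b) * (a + b) := by gcongr
      _ = a := div_mul_cancel₀ _ h0.ne'

/-- A field dominated by `f + g` splits proportionally into fields dominated by `f` and by `g`,
which gives `≤`; adding competitors gives `≥`. -/
lemma totalVariation_add (f g : C_c(X, ℝ≥0)) :
    totalVariation L (f + g) = totalVariation L f + totalVariation L g := by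
  have hfc : Continuous fun x => (f x : ℝ) := by fun_prop
  have hgc : Continuous fun x => (g x : ℝ) := by fun_prop
  apply NNReal.coe_injective
  rw [NNReal.coe_add]
  apply le_antisymm
  · refine totalVariation_le fun Y hY => ?_
    replace hY : ∀ x, ‖Y x‖ ≤ f x + g x := fun x => by simpa using hY x
    have b1 : ∀ x, ‖((f x : ℝ) / (f x + g x)) • Y x‖ ≤ f x := fun x =>
      norm_proportion_le (f x).2 (g x).2 (hY x)
    have b2 : ∀ x, ‖((g x : ℝ) / (g x + f x)) • Y x‖ ≤ g x := fun x =>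
      norm_proportion_le (g x).2 (f x).2 ((hY x).trans_eq (add_comm _ _))
    have b0 : ∀ x, ‖Y x‖ ≤ ‖Y‖ := Y.norm_coe_le_norm
    have c1 : ∀ x, ‖((f x : ℝ) / (f x + g x)) • Y x‖ ≤ ‖Y‖ := fun x => by
      rw [norm_smul, Real.norm_eq_abs, abs_of_nonneg (by positivity)]
      exact (mul_le_of_le_one_left (norm_nonneg _) (div_le_one_of_le₀ (by simp) (by positivity))).trans
        (b0 x)
    have c2 : ∀ x, ‖((g x : ℝ) / (g x + f x)) • Y x‖ ≤ ‖Y‖ := fun x => by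
      rw [norm_smul, Real.norm_eq_abs, abs_of_nonneg (by positivity)]
      exact (mul_le_of_le_one_left (norm_nonneg _) (div_le_one_of_le₀ (by simp) (by positivity))).trans
        (b0 x)
    let Y1 : X →ᵇ F := BoundedContinuousFunction.ofNormedAddCommGroup _
      (continuous_proportion hfc hgc (fun x => (f x).2) (fun x => (g x).2) Y.continuous hY) _ c1
    let Y2 : X →ᵇ F := BoundedContinuousFunction.ofNormedAddCommGroup _
      (continuous_proportion hgc hfc (fun x => (g x).2) (fun x => (f x).2) Y.continuous
        fun x => (hY x).trans_eq (add_comm _ _)) _ c2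
    have hsum : Y = Y1 + Y2 := by
      ext1 x
      change Y x = ((f x : ℝ) / (f x + g x)) • Y x + ((g x : ℝ) / (g x + f x)) • Y x
      rw [← add_smul, add_comm (g x : ℝ), ← add_div]
      rcases eq_or_ne ((f x : ℝ) + g x) 0 with h0 | h0
      · have : Y x = 0 := norm_le_zero_iff.1 (h0 ▸ hY x)
        rw [this, smul_zero]
      · rw [div_self h0, one_smul]
    rw [hsum, map_add]
    exact add_le_add (apply_le_totalVariation b1) (apply_le_totalVariation b2)
  · rw [← le_sub_iff_add_le]
    refine totalVariation_le fun Y hY => ?_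
    rw [le_sub_iff_add_le, add_comm, ← le_sub_iff_add_le]
    refine totalVariation_le fun Z hZ => ?_
    rw [le_sub_iff_add_le, ← map_add]
    refine apply_le_totalVariation fun x => ?_
    simpa [add_comm] using (norm_add_le (Z x) (Y x)).trans (add_le_add (hZ x) (hY x))

lemma mul_totalVariation_le (c : ℝ≥0) (f : C_c(X, ℝ≥0)) :
    c * totalVariation L f ≤ totalVariation L (c • f) := by
  rcases eq_or_ne c 0 with rfl | hc
  · simp
  have hc' : (0 : ℝ) < c := by positivity
  rw [← NNReal.coe_le_coe, NNReal.coe_mul, ← le_div_iff₀' hc']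
  refine totalVariation_le fun Y hY => ?_
  rw [le_div_iff₀' hc', ← smul_eq_mul, ← map_smul]
  refine apply_le_totalVariation fun x => ?_
  simpa [norm_smul] using mul_le_mul_of_nonneg_left (hY x) hc'.le

lemma totalVariation_smul (c : ℝ≥0) (f : C_c(X, ℝ≥0)) :
    totalVariation L (c • f) = c * totalVariation L f := by
  rcases eq_or_ne c 0 with rfl | hc
  · simp only [zero_smul, zero_mul]
    refine le_antisymm ?_ zero_le
    rw [← NNReal.coe_le_coe]
    refine totalVariation_le fun Y hY => ?_
    have : Y = 0 := by
      ext1 x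
      simpa using hY x
    simp [this]
  · refine le_antisymm ?_ (mul_totalVariation_le c f)
    -- The reverse inequality is the same estimate for the inverse scalar.
    have h := mul_totalVariation_le (L := L) c⁻¹ (c • f)
    rw [smul_smul, inv_mul_cancel₀ hc, one_smul] at h
    calc totalVariation L (c • f) = c * (c⁻¹ * totalVariation L (c • f)) := by
          rw [← mul_assoc, mul_inv_cancel₀ hc, one_mul]
      _ ≤ _ := by gcongr

variable (L) in
/-- The total variation of a functional as a linear map. -/
def totalVariationLinear : C_c(X, ℝ≥0) →ₗ[ℝ≥0] ℝ≥0 where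
  toFun := totalVariation L
  map_add' := totalVariation_add
  map_smul' := totalVariation_smul

/-- A bounded functional on vector fields is dominated, on compactly supported fields, by
integration against a finite measure. -/
theorem exists_measure_dominating [T2Space X] [LocallyCompactSpace X] [MeasurableSpace X]
    [BorelSpace X] (L : StrongDual ℝ (X →ᵇ F)) :
    ∃ μ : Measure X, IsFiniteMeasure μ ∧
      ∀ Y : X →ᵇ F, HasCompactSupport Y → |L Y| ≤ ∫ x, ‖Y x‖ ∂μ := by
  let μ := NNRealRMK.rieszMeasure (totalVariationLinear L)
  have hle : ∀ Y : X →ᵇ F, HasCompactSupport Y → L Y ≤ ∫ x, ‖Y x‖ ∂μ := fun Y hY => by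
    let f : C_c(X, ℝ≥0) := ⟨⟨fun x => ‖Y x‖₊, by fun_prop⟩, hY.comp_left (g := fun y => ‖y‖₊) (by simp)⟩
    have h1 := NNRealRMK.integral_rieszMeasure (totalVariationLinear L) f
    exact (apply_le_totalVariation (f := f) fun x => le_rfl).trans_eq h1.symm
  refine ⟨μ, ⟨?_⟩, fun Y hY => abs_le.2 ⟨?_, hle Y hY⟩⟩
  · refine lt_of_le_of_lt ?_ (ENNReal.ofReal_lt_top (r := ‖L‖ * 1))
    -- By inner regularity it suffices to bound compact sets; a cutoff with values in `[0, 1]` that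
    -- is `1` on `K` has total variation at most `‖L‖`.
    rw [isOpen_univ.measure_eq_iSup_isCompact]
    refine iSup₂_le fun K _ => iSup_le fun hK => ?_
    obtain ⟨φ, h1, -, h3, h4⟩ := exists_continuous_one_zero_of_isCompact hK isClosed_empty
      (disjoint_empty K)
    let f : C_c(X, ℝ≥0) := ⟨⟨fun x => (φ x).toNNReal, by fun_prop⟩,
      h3.comp_left (g := Real.toNNReal) (by simp)⟩
    calc μ K = ∫⁻ x, K.indicator 1 x ∂μ := (lintegral_indicator_one hK.measurableSet).symm
      _ ≤ ∫⁻ x, f x ∂μ := by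
        refine lintegral_mono fun x => ?_
        by_cases hx : x ∈ K
        · have : φ x = 1 := h1 hx
          simp [hx, f, this]
        · simp [hx]
      _ = totalVariation L f := NNRealRMK.lintegral_rieszMeasure (totalVariationLinear L) f
      _ ≤ ENNReal.ofReal (‖L‖ * 1) := by
        rw [← ENNReal.ofReal_coe_nnreal]
        refine ENNReal.ofReal_le_ofReal (totalVariation_le fun Y hY =>
          le_of_mem_dominatedValues L zero_le_one (f := f) (fun x => ?_) ⟨Y, hY, rfl⟩)
        simpa [f] using (h4 x).2
  · have h1 := hle (-Y) (by simpa using hY.neg)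
    rw [map_neg] at h1
    simp only [BoundedContinuousFunction.coe_neg, Pi.neg_apply, norm_neg] at h1
    linarith

end TotalVariation

/-! ### Representation by a density -/

/-- The bound makes `L` descend to a bounded functional on the range of `j`, which Hahn–Banach
extends. It serves twice: for test fields inside bounded continuous fields, and for their classes in
`L²`. -/
lemma exists_dual_factorization {S F : Type*} [AddCommGroup S] [Module ℝ S] [NormedAddCommGroup F]
    [NormedSpace ℝ F] (j : S →ₗ[ℝ] F) (L : S →ₗ[ℝ] ℝ) (C : ℝ) (h : ∀ x, |L x| ≤ C * ‖j x‖) :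
    ∃ l : StrongDual ℝ F, ∀ x, l (j x) = L x := by
  have hker : LinearMap.ker j ≤ LinearMap.ker L := fun x hx => by
    have := h x
    rw [LinearMap.mem_ker.1 hx, norm_zero, mul_zero] at this
    exact abs_nonpos_iff.1 this
  let f : LinearMap.range j →ₗ[ℝ] ℝ :=
    ((LinearMap.ker j).liftQ L hker) ∘ₗ (j.quotKerEquivRange.symm : LinearMap.range j →ₗ[ℝ] _)
  have hf : ∀ x, f ⟨j x, LinearMap.mem_range_self j x⟩ = L x := fun x => by
    have : j.quotKerEquivRange.symm ⟨j x, LinearMap.mem_range_self j x⟩ =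
        (LinearMap.ker j).mkQ x := by
      rw [LinearEquiv.symm_apply_eq]
      rfl
    simp only [f, LinearMap.comp_apply, LinearEquiv.coe_coe, this]
    exact Submodule.liftQ_apply _ _ _
  have hb : ∀ y, ‖f y‖ ≤ C * ‖y‖ := by
    rintro ⟨_, x, rfl⟩
    rw [hf]
    exact h x
  obtain ⟨l, hl, -⟩ := exists_extension_norm_eq _ (f.mkContinuous C hb)
  exact ⟨l, fun x => (hl ⟨j x, LinearMap.mem_range_self j x⟩).trans (hf x)⟩

/-- A functional that is dominated by integration against a finite measure has a square integrable
density. -/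
theorem exists_density {X F : Type*} [TopologicalSpace X] [MeasurableSpace X] [BorelSpace X]
    [NormedAddCommGroup F] [InnerProductSpace ℝ F] [CompleteSpace F] [SecondCountableTopology F]
    (μ : Measure X) [IsFiniteMeasure μ] (S : Submodule ℝ (X →ᵇ F)) (L : S →ₗ[ℝ] ℝ)
    (h : ∀ Y : S, |L Y| ≤ ∫ x, ‖(Y : X →ᵇ F) x‖ ∂μ) :
    ∃ g : X → F, StronglyMeasurable g ∧ Integrable g μ ∧
      ∀ Y : S, L Y = ∫ x, inner ℝ (g x) ((Y : X →ᵇ F) x) ∂μ := by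
  have : SecondCountableTopologyEither X F := inferInstance
  let j : S →ₗ[ℝ] Lp F 2 μ :=
    (BoundedContinuousFunction.toLp 2 μ ℝ : (X →ᵇ F) →L[ℝ] Lp F 2 μ).toLinearMap ∘ₗ S.subtype
  have hj : ∀ Y : S, j Y =ᵐ[μ] (Y : X →ᵇ F) := fun Y =>
    BoundedContinuousFunction.coeFn_toLp 2 μ ℝ (Y : X →ᵇ F)
  -- The constant is `μ(X)^(1/2)`, from the Cauchy–Schwarz bound of the `L¹` norm by the `L²` norm.
  obtain ⟨l, hl⟩ := exists_dual_factorization j L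
    ((μ univ ^ (1 / (1 : ℝ≥0∞).toReal - 1 / (2 : ℝ≥0∞).toReal)).toReal) fun Y => by
      refine (h Y).trans ?_
      have hm := Lp.memLp (j Y)
      calc ∫ x, ‖(Y : X →ᵇ F) x‖ ∂μ = ∫ x, ‖j Y x‖ ∂μ :=
            integral_congr_ae ((hj Y).mono fun x hx => by simp only [hx])
        _ = (eLpNorm (j Y) 1 μ).toReal := by
            rw [integral_norm_eq_lintegral_enorm hm.1, eLpNorm_one_eq_lintegral_enorm]
        _ ≤ (eLpNorm (j Y) 2 μ * μ univ ^ (1 / (1 : ℝ≥0∞).toReal - 1 / (2 : ℝ≥0∞).toReal)).toReal := by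
            refine ENNReal.toReal_mono (ENNReal.mul_ne_top hm.eLpNorm_ne_top ?_)
              (eLpNorm_le_eLpNorm_mul_rpow_measure_univ one_le_two hm.1)
            exact ENNReal.rpow_ne_top_of_nonneg (by norm_num) (measure_ne_top _ _)
        _ = _ := by rw [ENNReal.toReal_mul, mul_comm, Lp.norm_def]
  let g := (InnerProductSpace.toDual ℝ (Lp F 2 μ)).symm l
  refine ⟨g, Lp.stronglyMeasurable g, (Lp.memLp g).integrable one_le_two, fun Y => ?_⟩
  rw [← hl, ← InnerProductSpace.toDual_symm_apply, L2.inner_def]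
  exact integral_congr_ae ((hj Y).mono fun x hx => by simp only [hx, g])

/-! ### The first variation as a linear functional -/

lemma contDiff_coord {X : E n → E n} (hX : ContDiff ℝ 1 X) (j : Fin n) :
    ContDiff ℝ 1 fun y => X y j :=
  (EuclideanSpace.proj (𝕜 := ℝ) j : E n →L[ℝ] ℝ).contDiff.comp hX

lemma gradient_coord_eq_zero {X : E n → E n} {x : E n} (hx : x ∉ tsupport X) (j : Fin n) :
    gradient (fun y => X y j) x = 0 := by
  have h : x ∉ tsupport fun y => X y j := fun h =>
    hx (closure_mono (fun y hy => by
      rw [Function.mem_support] at hy ⊢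
      rintro h0
      simp [h0] at hy) h)
  simp [gradient, fderiv_of_notMem_tsupport ℝ h]

lemma continuous_gradient_coord {X : E n → E n} (hX : ContDiff ℝ 1 X) (j : Fin n) :
    Continuous (gradient fun y => X y j) :=
  (InnerProductSpace.toDual ℝ (E n)).symm.continuous.comp
    ((contDiff_coord hX j).continuous_fderiv one_ne_zero)

lemma continuous_tangentialDiv {X : E n → E n} (hX : ContDiff ℝ 1 X) :
    Continuous fun p : Ω × Gr d n => tangentialDiv p.2 X (p.1 : E n) := by
  unfold tangentialDiv
  refine continuous_finsetSum _ fun j _ => Continuous.inner ?_ continuous_const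
  exact (continuous_subtype_val.comp continuous_snd).clm_apply
    ((continuous_gradient_coord hX j).comp (continuous_subtype_val.comp continuous_fst))

lemma Varifold.integrable_tangentialDiv (V : Varifold d n Ω) {X : E n → E n}
    (hX : IsTestField Ω X) :
    Integrable (fun p : Ω × Gr d n => tangentialDiv p.2 X (p.1 : E n)) V.measure :=
  V.integrable_of_continuous (continuous_tangentialDiv hX.1) hX.2.1 hX.2.2 fun p hp => by
    simp [tangentialDiv, gradient_coord_eq_zero hp]

lemma tangentialDiv_add (P : Gr d n) {X Y : E n → E n} (hX : ContDiff ℝ 1 X)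
    (hY : ContDiff ℝ 1 Y) (x : E n) :
    tangentialDiv P (X + Y) x = tangentialDiv P X x + tangentialDiv P Y x := by
  simp only [tangentialDiv, ← Finset.sum_add_distrib]
  refine Finset.sum_congr rfl fun j _ => ?_
  have h : gradient (fun y => (X + Y) y j) x =
      gradient (fun y => X y j) x + gradient (fun y => Y y j) x := by
    rw [gradient, gradient, gradient, ← map_add, ← fderiv_fun_add
      ((contDiff_coord hX j).differentiable one_ne_zero x)
      ((contDiff_coord hY j).differentiable one_ne_zero x)]
    rfl
  rw [h, map_add, inner_add_left]

lemma tangentialDiv_smul (P : Gr d n) (c : ℝ) {X : E n → E n} (hX : ContDiff ℝ 1 X) (x : E n) :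
    tangentialDiv P (c • X) x = c * tangentialDiv P X x := by
  simp only [tangentialDiv, Finset.mul_sum]
  refine Finset.sum_congr rfl fun j _ => ?_
  have h : gradient (fun y => (c • X) y j) x = c • gradient (fun y => X y j) x := by
    rw [gradient, gradient, ← map_smul, ← fderiv_fun_const_smul
      ((contDiff_coord hX j).differentiable one_ne_zero x)]
    rfl
  rw [h, map_smul, real_inner_smul_left]

lemma IsTestField.add {X Y : E n → E n} (hX : IsTestField Ω X) (hY : IsTestField Ω Y) :
    IsTestField Ω (X + Y) :=
  ⟨hX.1.add hY.1, hX.2.1.add hY.2.1, (tsupport_add X Y).trans (union_subset hX.2.2 hY.2.2)⟩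

lemma IsTestField.smul {X : E n → E n} (hX : IsTestField Ω X) (c : ℝ) : IsTestField Ω (c • X) :=
  ⟨hX.1.const_smul c, hX.2.1.smul_left (f := fun _ => c),
    (tsupport_smul_subset_right (fun _ => c) X).trans hX.2.2⟩

lemma IsTestField.zero : IsTestField Ω (0 : E n → E n) :=
  ⟨contDiff_const, HasCompactSupport.zero, by simp⟩

/-- The space `C¹_c(Ω, ℝⁿ)` inside the bounded continuous fields. -/
def testFields (Ω : Set (E n)) : Submodule ℝ (E n →ᵇ E n) where
  carrier := {X | IsTestField Ω X}
  add_mem' hX hY := hX.add hY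
  zero_mem' := IsTestField.zero
  smul_mem' c _ hX := hX.smul c

/-- The first variation as a linear functional on `C¹_c(Ω, ℝⁿ)`. -/
def Varifold.firstVariationLinear (V : Varifold d n Ω) : testFields Ω →ₗ[ℝ] ℝ where
  toFun X := V.firstVariation (X : E n →ᵇ E n)
  map_add' X Y := by
    simp only [firstVariation]
    rw [← integral_add (V.integrable_tangentialDiv X.2) (V.integrable_tangentialDiv Y.2)]
    exact integral_congr_ae (.of_forall fun p => tangentialDiv_add p.2 X.2.1 Y.2.1 _)
  map_smul' c X := by
    simp only [firstVariation, RingHom.id_apply, smul_eq_mul]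
    rw [← integral_const_mul]
    exact integral_congr_ae (.of_forall fun p => tangentialDiv_smul p.2 c X.2.1 _)

/-- The first variation of a varifold with bounded first variation is represented by a finite
measure on `Ω` and an integrable density. -/
lemma Varifold.HasBoundedFirstVariation.exists_density {V : Varifold d n Ω} (hΩ : IsOpen Ω)
    (h : V.HasBoundedFirstVariation) :
    ∃ (μ : Measure (E n)) (g : E n → E n), IsFiniteMeasure μ ∧ μ Ωᶜ = 0 ∧ Measurable g ∧
      Integrable g μ ∧ ∀ X, IsTestField Ω X → V.firstVariation X = ∫ x, inner ℝ (g x) (X x) ∂μ := by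
  obtain ⟨c, hc⟩ := h
  obtain ⟨l, hl⟩ := exists_dual_factorization (S := testFields Ω) (testFields Ω).subtype V.firstVariationLinear |c|
    fun X => by
      refine (hc X X.2).trans ?_
      rw [Submodule.subtype_apply, BoundedContinuousFunction.norm_eq_iSup_norm]
      exact mul_le_mul_of_nonneg_right (le_abs_self c) (Real.iSup_nonneg fun _ => norm_nonneg _)
  obtain ⟨μ, hμ, hle⟩ := exists_measure_dominating l
  -- The Hahn–Banach extension may charge the complement of `Ω`; test fields vanish there, so
  -- restricting the measure does not affect the bound.
  obtain ⟨g, hg1, hg2, hg3⟩ := VarifoldCurvature.exists_density (μ.restrict Ω) (testFields Ω)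
    V.firstVariationLinear fun X => by
      rw [← hl, setIntegral_eq_integral_of_forall_compl_eq_zero fun x hx => ?_]
      · exact hle X X.2.2.1
      · rw [image_eq_zero_of_notMem_tsupport fun h => hx (X.2.2.2 h), norm_zero]
  refine ⟨μ.restrict Ω, g, inferInstance, ?_, hg1.measurable, hg2, fun X hX => ?_⟩
  · rw [Measure.restrict_apply hΩ.measurableSet.compl, compl_inter_self, measure_empty]
  · obtain ⟨C, hC⟩ := hX.1.continuous.bounded_above_of_compact_support hX.2.1
    exact hg3 ⟨BoundedContinuousFunction.ofNormedAddCommGroup X hX.1.continuous C hC, hX⟩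

/-! ### Existence of the generalized mean curvature -/

lemma Varifold.sigmaFinite_mass (V : Varifold d n Ω) (hΩ : IsOpen Ω) : SigmaFinite V.mass := by
  have : LocallyCompactSpace Ω := hΩ.locallyCompactSpace
  refine ⟨⟨⟨fun k => (↑) '' compactCovering Ω k ∪ Ωᶜ, fun _ => trivial, fun k => ?_, ?_⟩⟩⟩
  · refine (measure_union_le _ _).trans_lt ?_
    rw [V.mass_compl hΩ, add_zero]
    exact V.mass_lt_top ((isCompact_compactCovering Ω k).image continuous_subtype_val) (by simp)
  · rw [← iUnion_union, ← image_iUnion, iUnion_compactCovering, image_univ, Subtype.range_coe,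
      union_compl_self]

/-- With `δV = g μ`, the Lebesgue decomposition of `μ` relative to `‖V‖` gives `H = -(dμ/d‖V‖) g`.
On the singular part, `‖g‖` goes into the measure `σ` and `g/‖g‖` becomes the polar vector; zeros of
`g` are `σ`-null. -/
theorem Varifold.HasBoundedFirstVariation.exists_isMeanCurvatureDensity {V : Varifold d n Ω}
    (hΩ : IsOpen Ω) (h : V.HasBoundedFirstVariation) :
    ∃ H, V.IsMeanCurvatureDensity H := by
  obtain ⟨μ, g, hμ, hμΩ, hgm, hgi, hrep⟩ := h.exists_density hΩ
  have := V.sigmaFinite_mass hΩ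
  have hdec : μ.singularPart V.mass + V.mass.withDensity (μ.rnDeriv V.mass) = μ :=
    (Measure.haveLebesgueDecomposition_add μ V.mass).symm
  have hle1 : μ.singularPart V.mass ≤ μ := Measure.singularPart_le _ _
  have hle2 : V.mass.withDensity (μ.rnDeriv V.mass) ≤ μ := Measure.withDensity_rnDeriv_le _ _
  have hfm := Measure.measurable_rnDeriv μ V.mass
  have hft := Measure.rnDeriv_lt_top μ V.mass
  have hHi : Integrable (fun x => (μ.rnDeriv V.mass x).toReal • g x) V.mass :=
    (integrable_withDensity_iff_integrable_smul' hfm hft).1 (hgi.mono_measure hle2)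
  refine ⟨fun x => -((μ.rnDeriv V.mass x).toReal • g x),
    hHi.neg.locallyIntegrable.locallyIntegrableOn _,
    (μ.singularPart V.mass).withDensity fun x => ‖g x‖₊, fun x => ‖g x‖⁻¹ • g x,
    ?_, fun K _ _ => ?_, ?_, ?_, ?_, fun X hX => ?_⟩
  · exact withDensity_absolutelyContinuous _ _ (le_antisymm ((hle1 _).trans_eq hμΩ) zero_le)
  · refine (measure_mono (subset_univ K)).trans_lt ?_
    rw [withDensity_apply _ MeasurableSet.univ, Measure.restrict_univ]
    exact (hgi.mono_measure hle1).2
  · exact (Measure.mutuallySingular_singularPart μ V.mass).mono_ac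
      (withDensity_absolutelyContinuous _ _) Measure.AbsolutelyContinuous.rfl
  · fun_prop
  · rw [ae_withDensity_iff (by fun_prop)]
    refine .of_forall fun x hx => ?_
    have : ‖g x‖ ≠ 0 := by simpa using hx
    rw [norm_smul, norm_inv, norm_norm, inv_mul_cancel₀ this]
  · have hXi : Integrable (fun x => inner ℝ (g x) (X x)) μ := by
      obtain ⟨C, hC⟩ := hX.1.continuous.bounded_above_of_compact_support hX.2.1
      refine (hgi.norm.mul_const C).mono' ?_ (.of_forall fun x => ?_)
      · exact hgm.aestronglyMeasurable.inner hX.1.continuous.aestronglyMeasurable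
      · exact (norm_inner_le_norm _ _).trans (by gcongr; exact hC x)
    rw [hrep X hX]
    conv_lhs => rw [← hdec]
    rw [integral_add_measure (hXi.mono_measure hle1) (hXi.mono_measure hle2),
      integral_withDensity_eq_integral_toReal_smul hfm hft,
      integral_withDensity_eq_integral_smul (by fun_prop), add_comm, ← integral_neg]
    congr 1
    · refine integral_congr_ae (.of_forall fun x => ?_)
      simp only [inner_neg_right, neg_neg, real_inner_smul_right, smul_eq_mul]
      rw [real_inner_comm]
    · refine integral_congr_ae (.of_forall fun x => ?_)
      simp only [NNReal.smul_def, coe_nnnorm, real_inner_smul_right, smul_eq_mul]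
      rw [real_inner_comm]
      rcases eq_or_ne (g x) 0 with h0 | h0
      · simp [h0]
      · have : ‖g x‖ ≠ 0 := norm_ne_zero_iff.2 h0
        field_simp

lemma Varifold.HasBoundedFirstVariation.isMeanCurvatureDensity {V : Varifold d n Ω}
    (hΩ : IsOpen Ω) (h : V.HasBoundedFirstVariation) :
    V.IsMeanCurvatureDensity V.meanCurvature := by
  have hex := h.exists_isMeanCurvatureDensity hΩ
  rw [Varifold.meanCurvature, dif_pos hex]
  exact hex.choose_spec

/-! ### Lebesgue points -/

lemma ae_of_ae_restrict_ball {X : Type*} [PseudoMetricSpace X] [SecondCountableTopology X]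
    [MeasurableSpace X] [BorelSpace X] {m : Measure X} {U : Set X} (hU : m Uᶜ = 0) {P : X → Prop}
    (h : ∀ x ∈ U, ∃ r > 0, ∀ᵐ y ∂m.restrict (Metric.ball x r), P y) : ∀ᵐ x ∂m, P x := by
  have h1 : m ({x | ¬P x} ∩ U) = 0 := by
    refine measure_null_of_locally_null _ fun x hx => ?_
    obtain ⟨r, hr, hP⟩ := h x hx.2
    refine ⟨_, inter_mem_nhdsWithin _ (Metric.ball_mem_nhds x hr), ?_⟩
    rw [ae_restrict_iff' Metric.isOpen_ball.measurableSet] at hP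
    refine measure_mono_null (fun y hy => ?_) hP
    simp only [mem_compl_iff, mem_ofPred_eq, not_forall]
    exact ⟨hy.2, hy.1.1⟩
  refine measure_mono_null (fun x hx => ?_) (measure_union_null h1 hU)
  by_cases hxU : x ∈ U
  · exact Or.inl ⟨hx, hxU⟩
  · exact Or.inr hxU

/-- Besicovitch differentiation applies after restriction to a compact ball in `Ω`, where both
measures are finite; small balls around interior points do not notice the restriction. The second
limit is the Radon–Nikodym derivative of a singular measure, hence zero. -/
lemma ae_lebesgue_point {m σ : Measure (E n)} {H : E n → E n} (hΩ : IsOpen Ω) (hm0 : m Ωᶜ = 0)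
    (hm : ∀ K, IsCompact K → K ⊆ Ω → m K < ∞) (hσ : ∀ K, IsCompact K → K ⊆ Ω → σ K < ∞)
    (hH : LocallyIntegrableOn H Ω m) (hs : Measure.MutuallySingular σ m) :
    ∀ᵐ x ∂m,
      Tendsto (fun r => (m.real (Metric.closedBall x r))⁻¹ *
        ∫ y in Metric.closedBall x r, ‖H y - H x‖ ∂m) (𝓝[>] 0) (𝓝 0) ∧
      Tendsto (fun r => σ.real (Metric.closedBall x r) / m.real (Metric.closedBall x r))
        (𝓝[>] 0) (𝓝 0) := by
  refine ae_of_ae_restrict_ball hm0 fun x₀ hx₀ => ?_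
  obtain ⟨R, hR, hRΩ⟩ := Metric.nhds_basis_closedBall.mem_iff.1 (hΩ.mem_nhds hx₀)
  refine ⟨R, hR, ?_⟩
  set K := Metric.closedBall x₀ R with hK
  have hKc : IsCompact K := isCompact_closedBall _ _
  have : IsFiniteMeasure (m.restrict K) := ⟨by simpa using hm K hKc hRΩ⟩
  have : IsFiniteMeasure (σ.restrict K) := ⟨by simpa using hσ K hKc hRΩ⟩
  have hHi : Integrable H (m.restrict K) :=
    (hH.mono_set hRΩ).integrableOn_isCompact hKc
  have h1 := (Besicovitch.vitaliFamily (m.restrict K)).ae_tendsto_average_norm_sub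
    hHi.locallyIntegrable
  have h2 := Besicovitch.ae_tendsto_rnDeriv (σ.restrict K) (m.restrict K)
  have h3 : (σ.restrict K).rnDeriv (m.restrict K) =ᵐ[m.restrict K] 0 := (hs.mono_ac Measure.restrict_le_self.absolutelyContinuous
    (Measure.restrict_le_self (μ := m) (s := K)).absolutelyContinuous).rnDeriv_ae_eq_zero
  have hall := (h1.and (h2.and h3))
  have h4 : ∀ᵐ x ∂m.restrict (Metric.ball x₀ R), x ∈ Metric.ball x₀ R :=
    ae_restrict_mem Metric.isOpen_ball.measurableSet
  filter_upwards [ae_restrict_of_ae_restrict_of_subset Metric.ball_subset_closedBall hall, h4]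
    with x ⟨hx1, hx2, hx3⟩ hx4
  have hev : ∀ᶠ r in 𝓝[>] (0 : ℝ), Metric.closedBall x r ⊆ K := by
    have hpos : 0 < R - dist x x₀ := sub_pos.2 hx4
    filter_upwards [Ioo_mem_nhdsGT hpos] with r hr
    exact Metric.closedBall_subset_closedBall' (by linarith [hr.2])
  constructor
  · refine (hx1.comp (Besicovitch.tendsto_filterAt (m.restrict K) x)).congr' ?_
    filter_upwards [hev] with r hr
    rw [Function.comp_apply, setAverage_eq, smul_eq_mul, Measure.restrict_restrict_of_subset hr,
      measureReal_restrict_apply Metric.isClosed_closedBall.measurableSet, inter_eq_left.2 hr]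
  · rw [hx3] at hx2
    have h5 := (ENNReal.tendsto_toReal ENNReal.zero_ne_top).comp hx2
    refine h5.congr' ?_
    filter_upwards [hev] with r hr
    rw [Function.comp_apply, ENNReal.toReal_div,
      Measure.restrict_apply Metric.isClosed_closedBall.measurableSet,
      Measure.restrict_apply Metric.isClosed_closedBall.measurableSet, inter_eq_left.2 hr]
    rfl

/-! ### Asymptotics of the mass at a blow-up point -/

/-- A continuous radial cutoff, equal to `1` on `[-4, 4]` and to `0` outside `[-5, 5]`. -/
def cutoff (t : ℝ) : ℝ := max 0 (min 1 (5 - |t|))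

lemma continuous_cutoff : Continuous cutoff := by unfold cutoff; fun_prop

lemma cutoff_nonneg (t : ℝ) : 0 ≤ cutoff t := le_max_left _ _

lemma cutoff_eq_one {t : ℝ} (ht : |t| ≤ 4) : cutoff t = 1 := by
  rw [cutoff, min_eq_left (by linarith), max_eq_right zero_le_one]

lemma cutoff_eq_zero {t : ℝ} (ht : 5 < |t|) : cutoff t = 0 := by
  rw [cutoff, max_eq_left ((min_le_right _ _).trans (by linarith))]

lemma hasCompactSupport_cutoff : HasCompactSupport cutoff :=
  HasCompactSupport.intro (isCompact_closedBall (0 : ℝ) 5) fun t ht =>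
    cutoff_eq_zero (by simpa using ht)

/-- The Lebesgue integral of the radial cutoff over a `d`-dimensional space. -/
def cutoffIntegral (d : ℕ) : ℝ := ∫ w : E d, cutoff ‖w‖

lemma cutoffIntegral_nonneg (d : ℕ) : 0 ≤ cutoffIntegral d :=
  integral_nonneg fun _ => cutoff_nonneg _

lemma eventually_closedBall_subset (hΩ : IsOpen Ω) {x : E n} (hx : x ∈ Ω) {c : ℝ} (hc : 0 < c) :
    ∀ᶠ r in 𝓝[>] (0 : ℝ), Metric.closedBall x (c * r) ⊆ Ω := by
  obtain ⟨R, hR, hRΩ⟩ := Metric.nhds_basis_closedBall.mem_iff.1 (hΩ.mem_nhds hx)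
  filter_upwards [Ioo_mem_nhdsGT (div_pos hR hc)] with r hr
  refine (Metric.closedBall_subset_closedBall ?_).trans hRΩ
  have := hr.2
  rw [lt_div_iff₀ hc] at this
  linarith

lemma norm_inv_smul {r : ℝ} (hr : 0 < r) (w : E n) : ‖r⁻¹ • w‖ = ‖w‖ / r := by
  rw [norm_smul, norm_inv, Real.norm_of_nonneg hr.le, div_eq_inv_mul]

/-- The rescaled cutoff dominates the indicator of the ball, and its blow-up limit is strictly below
the stated constant. -/
lemma Varifold.eventually_mass_closedBall_le (V : Varifold d n Ω) (hΩ : IsOpen Ω) {x : E n}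
    (hx : x ∈ Ω) {θ : ℝ} (hθ : 0 < θ) (hb : HasRadialBlowup V.mass d x θ) :
    ∀ᶠ r in 𝓝[>] (0 : ℝ),
      V.mass.real (Metric.closedBall x (4 * r)) ≤ θ * (cutoffIntegral d + 1) * r ^ d := by
  have h1 := hb cutoff continuous_cutoff hasCompactSupport_cutoff
  have h2 : θ * cutoffIntegral d < θ * (cutoffIntegral d + 1) := by
    gcongr
    linarith
  filter_upwards [h1.eventually (gt_mem_nhds h2), self_mem_nhdsWithin,
    eventually_closedBall_subset hΩ hx (c := 5) (by norm_num)] with r hr hr0 hrΩ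
  replace hr0 : 0 < r := hr0
  rw [inv_mul_lt_iff₀ (by positivity), mul_comm] at hr
  refine le_trans ?_ hr.le
  have hi : Integrable (fun y => cutoff ‖r⁻¹ • (y - x)‖) V.mass := by
    refine V.integrable_mass (continuous_cutoff.comp (by fun_prop)) (isCompact_closedBall _ _) hrΩ
      fun y hy => cutoff_eq_zero ?_
    rw [abs_norm, norm_inv_smul hr0, lt_div_iff₀ hr0]
    simpa [dist_eq_norm] using hy
  rw [← integral_indicator_one Metric.isClosed_closedBall.measurableSet]
  refine integral_mono_of_nonneg (.of_forall fun y => indicator_nonneg (fun _ _ => zero_le_one) _)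
    hi (.of_forall fun y => ?_)
  by_cases hy : y ∈ Metric.closedBall x (4 * r)
  · have h4 : |‖r⁻¹ • (y - x)‖| ≤ 4 := by
      rw [abs_norm, norm_inv_smul hr0, div_le_iff₀ hr0]
      simpa [dist_eq_norm] using hy
    simp only [indicator_of_mem hy, cutoff_eq_one h4, Pi.one_apply, le_refl]
  · simp only [indicator_of_notMem hy, cutoff_nonneg]

lemma scaledKernel_neg (f : ℝ → ℝ) (ε : ℝ) (w : E n) :
    scaledKernel n f ε (-w) = scaledKernel n f ε w := by
  simp [scaledKernel]

lemma scaledKernel_sub_comm (f : ℝ → ℝ) (ε : ℝ) (x y : E n) :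
    scaledKernel n f ε (x - y) = scaledKernel n f ε (y - x) := by
  rw [← scaledKernel_neg, neg_sub]

lemma Varifold.tendsto_regMass (V : Varifold d n Ω) (hd : 1 ≤ d) {x : E n} {θ : ℝ}
    (hb : HasRadialBlowup V.mass d x θ) {f : ℝ → ℝ} (hf : IsKernelProfile n f) :
    Tendsto (fun r => (r ^ n * (r ^ d)⁻¹) * V.regMass f r x) (𝓝[>] 0)
      (𝓝 (θ * kernelConst d f)) := by
  have h1 := hb f hf.continuous hf.hasCompactSupport
  rw [hf.integral_radial hd] at h1
  refine h1.congr' ?_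
  filter_upwards [self_mem_nhdsWithin] with r hr
  have hr0 : (r : ℝ) ≠ 0 := ne_of_gt hr
  have h2 : ∀ y, scaledKernel n f r (x - y) = (r ^ n)⁻¹ * f ‖r⁻¹ • (y - x)‖ := fun y => by
    rw [scaledKernel_sub_comm, scaledKernel]
  simp only [regMass, h2, integral_const_mul]
  field_simp

/-! ### Convergence of the approximate mean curvature of a fixed varifold -/

lemma contDiff_scaledKernel {ρ : ℝ → ℝ} (h : ∀ t, ρ (-t) = ρ t) (hρ : ContDiff ℝ 1 ρ) {K : ℝ}
    (hK : ∀ s t, |deriv ρ s - deriv ρ t| ≤ K * |s - t|) (ε : ℝ) :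
    ContDiff ℝ 1 (scaledKernel n ρ ε) := by
  have hg := fun w : E n => hasGradientAt_scaledKernel h (hρ.differentiable one_ne_zero) ε w
  refine contDiff_one_iff_fderiv.2 ⟨fun w => (hg w).differentiableAt, ?_⟩
  have : fderiv ℝ (scaledKernel n ρ ε) = fun w =>
      InnerProductSpace.toDual ℝ (E n) (((ε ^ n)⁻¹ * ε⁻¹) • radialGrad ρ (ε⁻¹ • w)) :=
    funext fun w => (hg w).hasFDerivAt.fderiv
  rw [this]
  have hc := continuous_radialGrad (n := n) h hK
  exact (InnerProductSpace.toDual ℝ (E n)).continuous.comp (by fun_prop)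

lemma scaledKernel_eq_zero {f : ℝ → ℝ} (h : IsKernelProfile n f) {ε : ℝ} (hε : 0 < ε) {w : E n}
    (hw : ε < ‖w‖) : scaledKernel n f ε w = 0 := by
  rw [scaledKernel, h.eq_zero, mul_zero]
  rwa [abs_norm, norm_inv_smul hε, one_lt_div hε]

lemma tangentialDiv_kernel (P : Gr d n) {k : E n → ℝ} (hk : Differentiable ℝ k) (x e y : E n) :
    tangentialDiv P (fun y => k (y - x) • e) y = inner ℝ e (P.1 (gradient k (y - x))) := by
  have h : ∀ j, gradient (fun y => (k (y - x) • e) j) y = e j • gradient k (y - x) := fun j => by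
    have h1 : HasFDerivAt (fun y => k (y - x)) (fderiv ℝ k (y - x)) y := by
      have := (hk (y - x)).hasFDerivAt.comp y ((hasFDerivAt_id (𝕜 := ℝ) y).sub_const x)
      rwa [ContinuousLinearMap.comp_id] at this
    rw [gradient, gradient, ← map_smul]
    congr 1
    have h2 := h1.const_mul (e j)
    rw [← h2.fderiv]
    congr 1
    ext y
    simp [mul_comm]
  simp only [tangentialDiv, h, map_smul, PiLp.inner_apply]
  simp [mul_comm]

lemma continuous_gradient_scaledKernel {ρ : ℝ → ℝ} (h : ∀ t, ρ (-t) = ρ t) (hρ : ContDiff ℝ 1 ρ)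
    {K : ℝ} (hK : ∀ s t, |deriv ρ s - deriv ρ t| ≤ K * |s - t|) (ε : ℝ) :
    Continuous (gradient (scaledKernel n ρ ε)) :=
  (InnerProductSpace.toDual ℝ (E n)).symm.continuous.comp
    ((contDiff_scaledKernel h hρ hK ε).continuous_fderiv one_ne_zero)

lemma gradient_scaledKernel_eq_zero {ρ : ℝ → ℝ} (h : IsKernelProfile n ρ) {ε : ℝ} (hε : 0 < ε)
    {w : E n} (hw : ε < ‖w‖) : gradient (scaledKernel n ρ ε) w = 0 := by
  have h1 : scaledKernel n ρ ε =ᶠ[𝓝 w] fun _ => 0 := by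
    filter_upwards [(isOpen_lt continuous_const continuous_norm).mem_nhds hw] with v hv
    exact scaledKernel_eq_zero h hε hv
  rw [gradient, h1.fderiv_eq]
  simp

lemma Varifold.integrable_regFirstVariation (V : Varifold d n Ω) {ρ : ℝ → ℝ}
    (h : IsKernelProfile n ρ) (hρ : ContDiff ℝ 1 ρ) {K : ℝ}
    (hK : ∀ s t, |deriv ρ s - deriv ρ t| ≤ K * |s - t|) {ε : ℝ} (hε : 0 < ε) {x : E n}
    (hx : Metric.closedBall x ε ⊆ Ω) :
    Integrable (fun p : Ω × Gr d n => p.2.1 (gradient (scaledKernel n ρ ε) ((p.1 : E n) - x)))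
      V.measure := by
  refine V.integrable_of_continuous ?_ (isCompact_closedBall x ε) hx fun p hp => ?_
  · exact (continuous_subtype_val.comp continuous_snd).clm_apply
      ((continuous_gradient_scaledKernel h.even hρ hK ε).comp (by fun_prop))
  · rw [gradient_scaledKernel_eq_zero h hε (by simpa [dist_eq_norm] using hp), map_zero]

/-- This is what lets the representation of `δV` act on the regularized first variation, one
direction `e` at a time. -/
lemma Varifold.inner_regFirstVariation (V : Varifold d n Ω) {ρ : ℝ → ℝ}
    (h : IsKernelProfile n ρ) (hρ : ContDiff ℝ 1 ρ) {K : ℝ}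
    (hK : ∀ s t, |deriv ρ s - deriv ρ t| ≤ K * |s - t|) {ε : ℝ} (hε : 0 < ε) {x : E n}
    (hx : Metric.closedBall x ε ⊆ Ω) (e : E n) :
    inner ℝ e (V.regFirstVariation ρ ε x) =
      V.firstVariation fun y => scaledKernel n ρ ε (y - x) • e := by
  rw [regFirstVariation, firstVariation,
    ← integral_inner (V.integrable_regFirstVariation h hρ hK hε hx)]
  simp only [tangentialDiv_kernel _
    ((contDiff_scaledKernel (n := n) h.even hρ hK ε).differentiable one_ne_zero)]

lemma isTestField_kernel {ρ : ℝ → ℝ} (h : IsKernelProfile n ρ) (hρ : ContDiff ℝ 1 ρ) {K : ℝ}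
    (hK : ∀ s t, |deriv ρ s - deriv ρ t| ≤ K * |s - t|) {ε : ℝ} (hε : 0 < ε) {x : E n}
    (hx : Metric.closedBall x ε ⊆ Ω) (e : E n) :
    IsTestField Ω fun y => scaledKernel n ρ ε (y - x) • e := by
  have h0 : ∀ y ∉ Metric.closedBall x ε, scaledKernel n ρ ε (y - x) • e = 0 := fun y hy => by
    rw [scaledKernel_eq_zero h hε (by simpa [dist_eq_norm] using hy), zero_smul]
  refine ⟨?_, HasCompactSupport.intro (isCompact_closedBall x ε) h0,
    (closure_minimal (fun y hy => ?_) Metric.isClosed_closedBall).trans hx⟩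
  · exact ((contDiff_scaledKernel h.even hρ hK ε).comp (contDiff_id.sub contDiff_const)).smul
      contDiff_const
  · by_contra hne
    exact hy (h0 y hne)

/-- Freezing `H` at the value `H x` in the representation of `δV` leaves two errors, the oscillation
of `H` and the singular part, each weighted by a kernel bounded by `ε^(-n) sup ρ`. -/
lemma Varifold.norm_regFirstVariation_add_le (V : Varifold d n Ω) {ρ : ℝ → ℝ}
    (h : IsKernelProfile n ρ) (hρ : ContDiff ℝ 1 ρ) {K : ℝ}
    (hK : ∀ s t, |deriv ρ s - deriv ρ t| ≤ K * |s - t|) {H ν : E n → E n} {σ : Measure (E n)}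
    (hH : LocallyIntegrableOn H Ω V.mass) (hσ : ∀ K, IsCompact K → K ⊆ Ω → σ K < ∞)
    (hν : ∀ᵐ x ∂σ, ‖ν x‖ = 1)
    (hrep : ∀ X : E n → E n, IsTestField Ω X → V.firstVariation X =
      - (∫ x, inner ℝ (X x) (H x) ∂V.mass) + ∫ x, inner ℝ (X x) (ν x) ∂σ)
    {ε : ℝ} (hε : 0 < ε) {x : E n} (hx : Metric.closedBall x ε ⊆ Ω) :
    ‖V.regFirstVariation ρ ε x + V.regMass ρ ε x • H x‖ ≤ (ε ^ n)⁻¹ * supNorm ρ *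
      ((∫ y in Metric.closedBall x ε, ‖H y - H x‖ ∂V.mass) + σ.real (Metric.closedBall x ε)) := by
  set u := V.regFirstVariation ρ ε x + V.regMass ρ ε x • H x with hu
  set B := Metric.closedBall x ε with hB
  have hBc : IsCompact B := isCompact_closedBall _ _
  set k : E n → ℝ := fun y => scaledKernel n ρ ε (y - x) with hk
  have hkc : Continuous k :=
    (contDiff_scaledKernel h.even hρ hK ε).continuous.comp (by fun_prop)
  have hk0 : ∀ y ∉ B, k y = 0 := fun y hy =>
    scaledKernel_eq_zero h hε (by simpa [dist_eq_norm, hB] using hy)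
  set c := (ε ^ n)⁻¹ * supNorm ρ with hc
  have hc0 : 0 ≤ c := mul_nonneg (by positivity) (supNorm_nonneg ρ)
  have hkb : ∀ y, |k y| ≤ c := fun y => by
    rw [hk, hc]
    simp only [scaledKernel]
    rw [abs_mul, abs_of_pos (by positivity : 0 < (ε ^ n)⁻¹)]
    gcongr
    exact abs_le_supNorm h.continuous h.hasCompactSupport _
  have hHB : IntegrableOn H B V.mass := (hH.mono_set hx).integrableOn_isCompact hBc
  have hfin : V.mass B < ∞ := V.mass_lt_top hBc hx
  have hdiff : IntegrableOn (fun y => H y - H x) B V.mass :=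
    hHB.sub (integrableOn_const hfin.ne)
  have key : ∀ e, inner ℝ e u ≤ ‖e‖ * (c * ((∫ y in B, ‖H y - H x‖ ∂V.mass) + σ.real B)) := by
    intro e
    have hpt : ∀ (y v : E n), ‖inner ℝ (k y • e) v‖ ≤ c * ‖e‖ * ‖v‖ := fun y v => by
      refine (norm_inner_le_norm _ _).trans ?_
      rw [norm_smul]
      gcongr
      exact hkb y
    have hI1 : IntegrableOn (fun y => inner ℝ (k y • e) (H y)) B V.mass := by
      refine (hHB.norm.const_mul (c * ‖e‖)).mono' ?_ (.of_forall fun y => hpt y _)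
      exact (hkc.smul continuous_const).aestronglyMeasurable.inner hHB.1
    have hI2 : IntegrableOn (fun y => inner ℝ (k y • e) (H x)) B V.mass :=
      (integrableOn_const (C := c * ‖e‖ * ‖H x‖) hfin.ne).mono'
        ((hkc.smul continuous_const).inner continuous_const).aestronglyMeasurable
        (.of_forall fun y => hpt y _)
    have e1 : inner ℝ e (V.regFirstVariation ρ ε x) =
        -(∫ y in B, inner ℝ (k y • e) (H y) ∂V.mass) + ∫ y in B, inner ℝ (k y • e) (ν y) ∂σ := by
      rw [V.inner_regFirstVariation h hρ hK hε hx, hrep _ (isTestField_kernel h hρ hK hε hx e),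
        setIntegral_eq_integral_of_forall_compl_eq_zero fun y hy => ?_,
        setIntegral_eq_integral_of_forall_compl_eq_zero fun y hy => ?_]
      · rw [hk0 y hy, zero_smul, inner_zero_left]
      · rw [hk0 y hy, zero_smul, inner_zero_left]
    have e2 : inner ℝ e (V.regMass ρ ε x • H x) = ∫ y in B, inner ℝ (k y • e) (H x) ∂V.mass := by
      rw [setIntegral_eq_integral_of_forall_compl_eq_zero fun y hy => ?_]
      · simp only [real_inner_smul_left, real_inner_smul_right, integral_mul_const, regMass,
          scaledKernel_sub_comm ρ ε x, hk]
      · rw [hk0 y hy, zero_smul, inner_zero_left]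
    have e3 : inner ℝ e u = -(∫ y in B, inner ℝ (k y • e) (H y - H x) ∂V.mass)
        + ∫ y in B, inner ℝ (k y • e) (ν y) ∂σ := by
      simp only [inner_sub_right]
      rw [hu, inner_add_right, e1, e2, integral_sub hI1 hI2]
      ring
    have b1 : ‖∫ y in B, inner ℝ (k y • e) (H y - H x) ∂V.mass‖ ≤
        c * ‖e‖ * ∫ y in B, ‖H y - H x‖ ∂V.mass := by
      rw [← integral_const_mul]
      exact norm_integral_le_of_norm_le (hdiff.norm.const_mul _) (.of_forall fun y => hpt y _)
    have b2 : ‖∫ y in B, inner ℝ (k y • e) (ν y) ∂σ‖ ≤ c * ‖e‖ * σ.real B := by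
      refine norm_setIntegral_le_of_norm_le_const_ae (hσ B hBc hx) ?_
      filter_upwards [ae_restrict_of_ae hν] with y hy
      simpa [hy] using hpt y (ν y)
    rw [Real.norm_eq_abs] at b1 b2
    rw [e3]
    have := neg_le_of_abs_le b1
    have := le_of_abs_le b2
    linarith
  -- The direction `e = u` turns the scalar bounds into a bound on `‖u‖²`, and one factor cancels.
  have h1 := key u
  rw [real_inner_self_eq_norm_mul_norm] at h1
  rcases (norm_nonneg u).eq_or_lt with h0 | h0
  · rw [← h0]
    refine mul_nonneg hc0 (add_nonneg (integral_nonneg fun _ => norm_nonneg _) measureReal_nonneg)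
  · exact le_of_mul_le_mul_left h1 h0

lemma IsKernelProfile.kernelConst_pos {f : ℝ → ℝ} (h : IsKernelProfile n f) (hd : 1 ≤ d)
    (hdn : d < n) : 0 < kernelConst d f :=
  (kernelLowerBound_pos hd hdn).trans_le (kernelLowerBound_le h hd hdn)

/-- On a null ball the regularized mass would vanish, against its positive rescaled limit. -/
lemma Varifold.eventually_mass_closedBall_pos (V : Varifold d n Ω) (hΩ : IsOpen Ω) (hd : 1 ≤ d)
    (hdn : d < n) {x : E n} (hx : x ∈ Ω) {θ : ℝ} (hθ : 0 < θ) (hb : HasRadialBlowup V.mass d x θ)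
    {f : ℝ → ℝ} (hf : IsKernelProfile n f) :
    ∀ᶠ r in 𝓝[>] (0 : ℝ), 0 < V.mass.real (Metric.closedBall x r) := by
  have h1 := (V.tendsto_regMass hd hb hf).eventually
    (lt_mem_nhds (mul_pos hθ (hf.kernelConst_pos hd hdn)))
  filter_upwards [h1, self_mem_nhdsWithin, eventually_closedBall_subset hΩ hx one_pos]
    with r hr hr0 hrΩ
  rw [one_mul] at hrΩ
  refine ENNReal.toReal_pos (fun h0 => ?_) (V.mass_lt_top (isCompact_closedBall _ _) hrΩ).ne
  have h2 : V.regMass f r x = 0 := by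
    refine integral_eq_zero_of_ae ?_
    filter_upwards [measure_eq_zero_iff_ae_notMem.1 h0] with y hy
    rw [scaledKernel_sub_comm]
    exact scaledKernel_eq_zero hf hr0 (by simpa [dist_eq_norm] using hy)
  rw [h2, mul_zero] at hr
  exact lt_irrefl _ hr

lemma Varifold.tendsto_regFirstVariation (V : Varifold d n Ω) (hΩ : IsOpen Ω) (hd : 1 ≤ d)
    (hdn : d < n) {ρ : ℝ → ℝ} (h : IsKernelProfile n ρ) (hρ : ContDiff ℝ 1 ρ) {K : ℝ}
    (hK : ∀ s t, |deriv ρ s - deriv ρ t| ≤ K * |s - t|) {H ν : E n → E n} {σ : Measure (E n)}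
    (hH : LocallyIntegrableOn H Ω V.mass) (hσ : ∀ K, IsCompact K → K ⊆ Ω → σ K < ∞)
    (hν : ∀ᵐ x ∂σ, ‖ν x‖ = 1)
    (hrep : ∀ X : E n → E n, IsTestField Ω X → V.firstVariation X =
      - (∫ x, inner ℝ (X x) (H x) ∂V.mass) + ∫ x, inner ℝ (X x) (ν x) ∂σ)
    {x : E n} (hx : x ∈ Ω) {θ : ℝ} (hθ : 0 < θ) (hb : HasRadialBlowup V.mass d x θ)
    (hx1 : Tendsto (fun r => (V.mass.real (Metric.closedBall x r))⁻¹ *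
        ∫ y in Metric.closedBall x r, ‖H y - H x‖ ∂V.mass) (𝓝[>] 0) (𝓝 0))
    (hx2 : Tendsto (fun r => σ.real (Metric.closedBall x r) / V.mass.real (Metric.closedBall x r))
        (𝓝[>] 0) (𝓝 0)) :
    Tendsto (fun r => (r ^ n * (r ^ d)⁻¹) • V.regFirstVariation ρ r x) (𝓝[>] 0)
      (𝓝 (-(θ * kernelConst d ρ) • H x)) := by
  have h1 : Tendsto (fun r => (r ^ n * (r ^ d)⁻¹) •
      (V.regFirstVariation ρ r x + V.regMass ρ r x • H x)) (𝓝[>] 0) (𝓝 0) := by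
    have hlim := (hx1.add hx2).const_mul (supNorm ρ * (θ * (cutoffIntegral d + 1)))
    rw [add_zero, mul_zero] at hlim
    refine squeeze_zero_norm' ?_ hlim
    filter_upwards [V.eventually_mass_closedBall_pos hΩ hd hdn hx hθ hb h,
      V.eventually_mass_closedBall_le hΩ hx hθ hb, self_mem_nhdsWithin,
      eventually_closedBall_subset hΩ hx one_pos,
      eventually_closedBall_subset hΩ hx (c := 4) (by norm_num)] with r hm1 hm2 hr hrΩ hrΩ4
    replace hr : 0 < r := hr
    rw [one_mul] at hrΩ
    have hm3 : V.mass.real (Metric.closedBall x r) ≤ θ * (cutoffIntegral d + 1) * r ^ d := by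
      refine le_trans ?_ hm2
      exact measureReal_mono (Metric.closedBall_subset_closedBall (by linarith))
        (V.mass_lt_top (isCompact_closedBall _ _) hrΩ4).ne
    have hest := V.norm_regFirstVariation_add_le h hρ hK hH hσ hν hrep hr hrΩ
    set m := V.mass.real (Metric.closedBall x r)
    set I := ∫ y in Metric.closedBall x r, ‖H y - H x‖ ∂V.mass
    have hI : 0 ≤ I := integral_nonneg fun _ => norm_nonneg _
    have hS : 0 ≤ σ.real (Metric.closedBall x r) := measureReal_nonneg
    set S := σ.real (Metric.closedBall x r)
    have hsup := supNorm_nonneg ρ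
    rw [norm_smul, Real.norm_of_nonneg (by positivity)]
    calc r ^ n * (r ^ d)⁻¹ * ‖V.regFirstVariation ρ r x + V.regMass ρ r x • H x‖
        ≤ r ^ n * (r ^ d)⁻¹ * ((r ^ n)⁻¹ * supNorm ρ * (I + S)) := by gcongr
      -- Inserting the mass `m` of the ball separates a bounded density ratio from the quantities
      -- that tend to zero.
      _ = supNorm ρ * (m * (r ^ d)⁻¹) * (m⁻¹ * I + S / m) := by
        field_simp
      _ ≤ supNorm ρ * (θ * (cutoffIntegral d + 1)) * (m⁻¹ * I + S / m) := by
        refine mul_le_mul_of_nonneg_right (mul_le_mul_of_nonneg_left ?_ hsup) (by positivity)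
        rwa [← div_eq_mul_inv, div_le_iff₀ (by positivity)]
  have h2 := h1.sub ((V.tendsto_regMass hd hb h).smul_const (H x))
  rw [zero_sub, ← neg_smul] at h2
  refine h2.congr fun r => ?_
  rw [smul_add, smul_smul]
  abel

/-- Used with `s = ε^(n-d)`, the scaling under which numerator and denominator both have finite
limits. -/
lemma Varifold.approxMeanCurvature_eq (V : Varifold d n Ω) (ρ ξ : ℝ → ℝ) (ε : ℝ) (x : E n) {s : ℝ}
    (hs : s ≠ 0) : V.approxMeanCurvature ρ ξ ε x =
      -((kernelConst d ξ / kernelConst d ρ) •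
        ((s * V.regMass ξ ε x)⁻¹ • (s • V.regFirstVariation ρ ε x))) := by
  rw [approxMeanCurvature, smul_smul (s * V.regMass ξ ε x)⁻¹, mul_inv, mul_right_comm,
    inv_mul_cancel₀ hs, one_mul]

/-- At almost every point the approximate mean curvatures of a rectifiable varifold with bounded
first variation converge to the generalized mean curvature. -/
theorem Varifold.ae_tendsto_approxMeanCurvature {V : Varifold d n Ω} (hΩ : IsOpen Ω) (hd : 1 ≤ d)
    (hdn : d < n) (hV : V.IsRectifiable) (hδV : V.HasBoundedFirstVariation) {ρ ξ : ℝ → ℝ}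
    (hk : IsRegularKernelPair n ρ ξ) :
    ∀ᵐ x ∂V.mass, x ∈ Ω ∧ ∃ θ, 0 < θ ∧ HasRadialBlowup V.mass d x θ ∧
      Tendsto (fun r => V.approxMeanCurvature ρ ξ r x) (𝓝[>] 0) (𝓝 (V.meanCurvature x)) := by
  obtain ⟨hH, σ, ν, -, hσ, hs, -, hν, hrep⟩ := hδV.isMeanCurvatureDensity hΩ
  obtain ⟨K, hK⟩ := hk.lipschitz_deriv_left
  have hΩae : ∀ᵐ x ∂V.mass, x ∈ Ω := V.mass_compl hΩ
  filter_upwards [hΩae, hV.ae_hasRadialBlowup,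
    ae_lebesgue_point hΩ (V.mass_compl hΩ) (fun _ => V.mass_lt_top) hσ hH hs]
    with x hx ⟨θ, hθ, hb⟩ ⟨hx1, hx2⟩
  refine ⟨hx, θ, hθ, hb, ?_⟩
  have hρ0 := hk.profile_left.kernelConst_pos hd hdn
  have hξ0 := hk.profile_right.kernelConst_pos hd hdn
  have h1 := V.tendsto_regFirstVariation hΩ hd hdn hk.profile_left hk.contDiff_left
    (abs_deriv_sub_le_normW2 hK) hH hσ hν hrep hx hθ hb hx1 hx2
  have h2 := (V.tendsto_regMass hd hb hk.profile_right).inv₀ (by positivity)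
  have h3 := ((h2.smul h1).const_smul (kernelConst d ξ / kernelConst d ρ)).neg
  convert! h3.congr' ?_ using 2
  · rw [smul_smul, smul_smul, ← neg_smul]
    have : -(kernelConst d ξ / kernelConst d ρ *
        (θ * kernelConst d ξ)⁻¹ * -(θ * kernelConst d ρ)) = 1 := by
      field_simp
    rw [this, one_smul]
  · filter_upwards [self_mem_nhdsWithin] with r hr
    replace hr : 0 < r := hr
    exact (V.approxMeanCurvature_eq ρ ξ r x (by positivity)).symm

/-! ### Comparison of two varifolds -/

/-- The intermediate quantity is the integral of the kernel centered at `z` against `V`. Both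
kernels live in the closed `2ε`-ball about `x`, hence have closed support in the open `3ε`-ball,
whose `η`-thickening stays within `4ε`. -/
lemma Varifold.abs_integral_sub_le (V W : Varifold d n Ω) {x z : E n} {ε η δ : ℝ} (hε : 0 < ε)
    (hxz : ‖x - z‖ ≤ ε) (hx : Metric.closedBall x (4 * ε) ⊆ Ω) (hη : 0 < η) (hηε : η ≤ ε)
    (hδ : 0 ≤ δ)
    (hΔ : bddLipDist (Metric.ball x (3 * ε)) V W ≤ ENNReal.ofReal δ *
      V.mass (Metric.thickening η (Metric.ball x (3 * ε))))
    {F : E n → Gr d n → ℝ} {L : ℝ} (hL : 0 < L)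
    (hLip : ∀ w w' P P', |F w P - F w' P'| ≤ L * max ‖w - w'‖ (dist P P'))
    (hF : ∀ w P, |F w P| ≤ L) (h0 : ∀ w P, ε < ‖w‖ → F w P = 0) :
    |(∫ p, F ((p.1 : E n) - z) p.2 ∂W.measure) - ∫ p, F ((p.1 : E n) - x) p.2 ∂V.measure| ≤
      L * (δ + ‖x - z‖) * V.mass.real (Metric.closedBall x (4 * ε)) := by
  set B := Metric.closedBall x (4 * ε) with hB
  have hBc : IsCompact B := isCompact_closedBall _ _
  have hfin : V.mass B < ∞ := V.mass_lt_top hBc hx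
  have hcont : ∀ v : E n, LipschitzWith L.toNNReal fun p : Ω × Gr d n => F ((p.1 : E n) - v) p.2 := by
    refine fun v => LipschitzWith.of_dist_le_mul fun p q => ?_
    rw [Real.coe_toNNReal _ hL.le, Real.dist_eq]
    refine (hLip _ _ _ _).trans_eq ?_
    rw [sub_sub_sub_cancel_right, Prod.dist_eq, Subtype.dist_eq p.1, dist_eq_norm (p.1 : E n)]
  have hsupp : ∀ v : E n, ‖x - v‖ ≤ ε → ∀ p : Ω × Gr d n,
      (p.1 : E n) ∉ Metric.closedBall x (2 * ε) → F ((p.1 : E n) - v) p.2 = 0 := fun v hv p hp => by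
    refine h0 _ _ ?_
    rw [Metric.mem_closedBall, dist_eq_norm, not_le] at hp
    have := norm_sub_le_norm_sub_add_norm_sub (p.1 : E n) v x
    rw [norm_sub_rev v x] at this
    linarith
  have h2B : Metric.closedBall x (2 * ε) ⊆ B := Metric.closedBall_subset_closedBall (by linarith)
  have hint : ∀ (U : Varifold d n Ω) (v : E n), ‖x - v‖ ≤ ε →
      Integrable (fun p : Ω × Gr d n => F ((p.1 : E n) - v) p.2) U.measure := fun U v hv =>
    U.integrable_of_continuous (hcont v).continuous (isCompact_closedBall x (2 * ε))
      (h2B.trans hx) (hsupp v hv)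
  have step1 : |(∫ p, F ((p.1 : E n) - z) p.2 ∂V.measure) -
      ∫ p, F ((p.1 : E n) - z) p.2 ∂W.measure| ≤ L * (δ * V.mass.real B) := by
    -- Division by `L` makes the kernel an admissible competitor, as `L` bounds both its size and
    -- its Lipschitz constant.
    have h1 : ENNReal.ofReal |(∫ p, L⁻¹ * F ((p.1 : E n) - z) p.2 ∂V.measure) -
        ∫ p, L⁻¹ * F ((p.1 : E n) - z) p.2 ∂W.measure| ≤ ENNReal.ofReal (δ * V.mass.real B) := by
      have hmem : LipschitzWith 1 (fun p : Ω × Gr d n => L⁻¹ * F ((p.1 : E n) - z) p.2) ∧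
          (∀ p : Ω × Gr d n, |L⁻¹ * F ((p.1 : E n) - z) p.2| ≤ 1) ∧
          tsupport (fun p : Ω × Gr d n => L⁻¹ * F ((p.1 : E n) - z) p.2) ⊆
            {p | (p.1 : E n) ∈ Metric.ball x (3 * ε)} ∧
          Integrable (fun p : Ω × Gr d n => L⁻¹ * F ((p.1 : E n) - z) p.2) V.measure ∧
          Integrable (fun p : Ω × Gr d n => L⁻¹ * F ((p.1 : E n) - z) p.2) W.measure := by
        refine ⟨LipschitzWith.of_dist_le_mul fun p q => ?_, fun p => ?_, ?_,
          (hint V z hxz).const_mul _, (hint W z hxz).const_mul _⟩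
        · have h2 := (hcont z).dist_le_mul p q
          rw [Real.coe_toNNReal _ hL.le] at h2
          rw [Real.dist_eq, ← mul_sub, abs_mul, abs_of_pos (inv_pos.2 hL), NNReal.coe_one, one_mul,
            inv_mul_le_iff₀ hL]
          exact h2
        · rw [abs_mul, abs_of_pos (inv_pos.2 hL), inv_mul_le_iff₀ hL, mul_one]
          exact hF _ _
        · have h3 : tsupport (fun p : Ω × Gr d n => L⁻¹ * F ((p.1 : E n) - z) p.2) ⊆
              {p | (p.1 : E n) ∈ Metric.closedBall x (2 * ε)} := by
            refine closure_minimal (fun p hp => ?_) (Metric.isClosed_closedBall.preimage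
              (continuous_subtype_val.comp continuous_fst))
            by_contra hne
            exact hp (by simp only [hsupp z hxz p hne, mul_zero])
          intro p hp
          exact Metric.closedBall_subset_ball (by linarith) (h3 hp)
      have hle : ENNReal.ofReal δ * V.mass (Metric.thickening η (Metric.ball x (3 * ε))) ≤
          ENNReal.ofReal (δ * V.mass.real B) := by
        rw [ENNReal.ofReal_mul hδ, ofReal_measureReal hfin.ne]
        gcongr
        rw [thickening_ball hη (by positivity)]
        exact Metric.ball_subset_closedBall.trans (Metric.closedBall_subset_closedBall (by linarith))
      exact (le_iSup₂_of_le (f := fun (φ : Ω × Gr d n → ℝ) _ =>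
        ENNReal.ofReal |(∫ p, φ p ∂V.measure) - ∫ p, φ p ∂W.measure|) _ hmem le_rfl).trans
        (hΔ.trans hle)
    rw [ENNReal.ofReal_le_ofReal_iff (by positivity), integral_const_mul, integral_const_mul,
      ← mul_sub, abs_mul, abs_of_pos (inv_pos.2 hL), inv_mul_le_iff₀ hL] at h1
    exact h1
  have step2 : |(∫ p, F ((p.1 : E n) - z) p.2 ∂V.measure) -
      ∫ p, F ((p.1 : E n) - x) p.2 ∂V.measure| ≤ L * ‖x - z‖ * V.mass.real B := by
    have hx0 : ‖x - x‖ ≤ ε := by simpa using hε.le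
    have hBm : V.mass B = V.measure {p | (p.1 : E n) ∈ B} := V.mass_apply hBc.measurableSet
    rw [← integral_sub (hint V z hxz) (hint V x hx0),
      ← setIntegral_eq_integral_of_forall_compl_eq_zero (s := {p | (p.1 : E n) ∈ B})
        fun p hp => ?_]
    · rw [measureReal_def, hBm, ← measureReal_def, ← Real.norm_eq_abs]
      refine norm_setIntegral_le_of_norm_le_const (hBm ▸ hfin) fun p _ => ?_
      refine (hLip _ _ _ _).trans_eq ?_
      rw [sub_sub_sub_cancel_left, dist_self, max_eq_left (norm_nonneg _)]
    · rw [hsupp z hxz p fun h => hp (h2B h), hsupp x hx0 p fun h => hp (h2B h), sub_zero]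
  rw [abs_sub_comm] at step1
  calc _ ≤ _ := abs_sub_le _ (∫ p, F ((p.1 : E n) - z) p.2 ∂V.measure) _
    _ ≤ L * (δ * V.mass.real B) + L * ‖x - z‖ * V.mass.real B := add_le_add step1 step2
    _ = _ := by ring

lemma gradient_scaledKernel {ρ : ℝ → ℝ} (h : ∀ t, ρ (-t) = ρ t) (hd : Differentiable ℝ ρ)
    (ε : ℝ) (w : E n) :
    gradient (scaledKernel n ρ ε) w = ((ε ^ n)⁻¹ * ε⁻¹) • radialGrad ρ (ε⁻¹ • w) :=
  (hasGradientAt_scaledKernel h hd ε w).gradient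

/-- The factor `4` is `3` for varying the point plus `1` for varying the plane; `ε ≤ 1` lets the
latter term, of order `ε^(-n-1)`, be counted as `ε^(-n-2)`. -/
lemma abs_inner_gradient_sub_le {ρ : ℝ → ℝ} (h : ∀ t, ρ (-t) = ρ t) (hd : Differentiable ℝ ρ)
    {N : ℝ} (hN : ∀ t, |deriv ρ t| ≤ N) (hK : ∀ s t, |deriv ρ s - deriv ρ t| ≤ N * |s - t|)
    {ε : ℝ} (hε : 0 < ε) (hε1 : ε ≤ 1) {u : E n} (hu : ‖u‖ ≤ 1) (w w' : E n) (P P' : Gr d n) :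
    |inner ℝ u (P.1 (gradient (scaledKernel n ρ ε) w)) -
      inner ℝ u (P'.1 (gradient (scaledKernel n ρ ε) w'))| ≤
      4 * N * (ε ^ n)⁻¹ * (ε ^ 2)⁻¹ * max ‖w - w'‖ (dist P P') := by
  have hN0 : 0 ≤ N := (abs_nonneg _).trans (hN 0)
  rw [gradient_scaledKernel h hd, gradient_scaledKernel h hd, ← inner_sub_right]
  set v := radialGrad ρ (ε⁻¹ • w)
  set v' := radialGrad ρ (ε⁻¹ • w') with hv'
  have h1 : ‖v - v'‖ ≤ 3 * N * (ε⁻¹ * ‖w - w'‖) := by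
    refine (norm_radialGrad_sub_le h hK _ _).trans_eq ?_
    rw [← smul_sub, norm_smul, norm_inv, Real.norm_of_nonneg hε.le]
  have h2 : ‖v'‖ ≤ N := by
    rw [hv', norm_radialGrad h]
    exact hN _
  have h3 : ‖P.1 v - P'.1 v'‖ ≤ 3 * N * (ε⁻¹ * ‖w - w'‖) + dist P P' * N := by
    have e : P.1 v - P'.1 v' = P.1 (v - v') + (P.1 - P'.1) v' := by
      rw [map_sub, sub_apply]
      abel
    rw [e]
    refine (norm_add_le _ _).trans (add_le_add ((P.norm_apply_le _).trans h1) ?_)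
    rw [Subtype.dist_eq, dist_eq_norm]
    exact (ContinuousLinearMap.le_opNorm _ _).trans (by gcongr)
  have hε' : 1 ≤ ε⁻¹ := (one_le_inv₀ hε).2 hε1
  rw [map_smul, map_smul, ← smul_sub]
  calc |inner ℝ u (((ε ^ n)⁻¹ * ε⁻¹) • (P.1 v - P'.1 v'))|
      ≤ 1 * (((ε ^ n)⁻¹ * ε⁻¹) * ‖P.1 v - P'.1 v'‖) := by
        refine (abs_real_inner_le_norm _ _).trans ?_
        rw [norm_smul, Real.norm_of_nonneg (by positivity)]
        gcongr
    _ ≤ 1 * (((ε ^ n)⁻¹ * ε⁻¹) * (3 * N * (ε⁻¹ * max ‖w - w'‖ (dist P P')) +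
          (ε⁻¹ * max ‖w - w'‖ (dist P P')) * N)) := by
        have h4 : dist P P' ≤ ε⁻¹ * max ‖w - w'‖ (dist P P') :=
          (le_max_right _ _).trans (le_mul_of_one_le_left (le_max_of_le_left (norm_nonneg _)) hε')
        refine mul_le_mul_of_nonneg_left (mul_le_mul_of_nonneg_left (h3.trans ?_) (by positivity))
          zero_le_one
        gcongr
        exact le_max_left _ _
    _ = 4 * N * (ε ^ n)⁻¹ * (ε ^ 2)⁻¹ * max ‖w - w'‖ (dist P P') := by
        field_simp
        ring

lemma abs_inner_gradient_le {ρ : ℝ → ℝ} (h : ∀ t, ρ (-t) = ρ t) (hd : Differentiable ℝ ρ)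
    {N : ℝ} (hN : ∀ t, |deriv ρ t| ≤ N) {ε : ℝ} (hε : 0 < ε) (hε1 : ε ≤ 1) {u : E n}
    (hu : ‖u‖ ≤ 1) (w : E n) (P : Gr d n) :
    |inner ℝ u (P.1 (gradient (scaledKernel n ρ ε) w))| ≤ 4 * N * (ε ^ n)⁻¹ * (ε ^ 2)⁻¹ := by
  have hN0 : 0 ≤ N := (abs_nonneg _).trans (hN 0)
  have hε' : 1 ≤ ε⁻¹ := (one_le_inv₀ hε).2 hε1
  rw [gradient_scaledKernel h hd]
  calc _ ≤ 1 * (((ε ^ n)⁻¹ * ε⁻¹) * N) := by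
        refine (abs_real_inner_le_norm _ _).trans (mul_le_mul hu ((P.norm_apply_le _).trans ?_)
          (norm_nonneg _) zero_le_one)
        rw [norm_smul, Real.norm_of_nonneg (by positivity), norm_radialGrad h]
        gcongr
        exact hN _
    _ ≤ 4 * (((ε ^ n)⁻¹ * (ε⁻¹ * ε⁻¹)) * N) := by
        gcongr
        · norm_num
        · exact le_mul_of_one_le_left (by positivity) hε'
    _ = _ := by
        rw [pow_two, mul_inv]
        ring

/-- Comparison of the regularized first variations of two varifolds. -/
lemma Varifold.norm_regFirstVariation_sub_le (V W : Varifold d n Ω) {x z : E n} {ε η δ : ℝ}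
    (hε : 0 < ε) (hε1 : ε ≤ 1) (hxz : ‖x - z‖ ≤ ε) (hx : Metric.closedBall x (4 * ε) ⊆ Ω)
    (hη : 0 < η) (hηε : η ≤ ε) (hδ : 0 ≤ δ)
    (hΔ : bddLipDist (Metric.ball x (3 * ε)) V W ≤ ENNReal.ofReal δ *
      V.mass (Metric.thickening η (Metric.ball x (3 * ε))))
    {ρ ξ : ℝ → ℝ} (hk : IsRegularKernelPair n ρ ξ) :
    ‖W.regFirstVariation ρ ε z - V.regFirstVariation ρ ε x‖ ≤
      4 * normW2 ρ * (ε ^ n)⁻¹ * (ε ^ 2)⁻¹ * (δ + ‖x - z‖) *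
        V.mass.real (Metric.closedBall x (4 * ε)) := by
  obtain ⟨K, hK⟩ := hk.lipschitz_deriv_left
  have hρ := hk.profile_left
  have hN := normW2_pos hρ
  have hK' := abs_deriv_sub_le_normW2 hK
  set v := W.regFirstVariation ρ ε z - V.regFirstVariation ρ ε x with hv
  -- Pairing with the direction of the difference itself reduces the vector estimate to a scalar
  -- one; if `v = 0` then `u = 0`, which is harmless.
  set u := ‖v‖⁻¹ • v with hu
  have hu1 : ‖u‖ ≤ 1 := by
    rw [hu, norm_smul, norm_inv, norm_norm]
    exact inv_mul_le_one
  have hz : Metric.closedBall z ε ⊆ Ω := by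
    refine (Metric.closedBall_subset_closedBall' ?_).trans hx
    rw [dist_comm, dist_eq_norm]
    linarith
  have hx' : Metric.closedBall x ε ⊆ Ω :=
    (Metric.closedBall_subset_closedBall (by linarith)).trans hx
  have e1 : inner ℝ u v = ‖v‖ := by
    rw [hu, real_inner_smul_left, real_inner_self_eq_norm_mul_norm]
    rcases eq_or_ne ‖v‖ 0 with h0 | h0
    · simp [h0]
    · rw [inv_mul_cancel_left₀ h0]
  have hd := hk.contDiff_left.differentiable one_ne_zero
  have hmain := V.abs_integral_sub_le W hε hxz hx hη hηε hδ hΔ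
    (F := fun w P => inner ℝ u (P.1 (gradient (scaledKernel n ρ ε) w)))
    (L := 4 * normW2 ρ * (ε ^ n)⁻¹ * (ε ^ 2)⁻¹) (by positivity)
    (abs_inner_gradient_sub_le hρ.even hd (abs_deriv_le_normW2 hρ hk.contDiff_left) hK' hε hε1 hu1)
    (abs_inner_gradient_le hρ.even hd (abs_deriv_le_normW2 hρ hk.contDiff_left) hε hε1 hu1)
    (fun w P hw => by rw [gradient_scaledKernel_eq_zero hρ hε hw, map_zero, inner_zero_right])
  rw [integral_inner (W.integrable_regFirstVariation hρ hk.contDiff_left hK' hε hz),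
    integral_inner (V.integrable_regFirstVariation hρ hk.contDiff_left hK' hε hx'),
    ← inner_sub_right] at hmain
  exact e1.symm.trans_le ((le_abs_self _).trans hmain)

/-- Comparison of the regularized masses of two varifolds. -/
lemma Varifold.abs_regMass_sub_le (V W : Varifold d n Ω) {x z : E n} {ε η δ : ℝ}
    (hε : 0 < ε) (hε1 : ε ≤ 1) (hxz : ‖x - z‖ ≤ ε) (hx : Metric.closedBall x (4 * ε) ⊆ Ω)
    (hη : 0 < η) (hηε : η ≤ ε) (hδ : 0 ≤ δ)
    (hΔ : bddLipDist (Metric.ball x (3 * ε)) V W ≤ ENNReal.ofReal δ *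
      V.mass (Metric.thickening η (Metric.ball x (3 * ε))))
    {ξ : ℝ → ℝ} (hξ : IsKernelProfile n ξ) {K : ℝ≥0} (hK : LipschitzWith K ξ) :
    |W.regMass ξ ε z - V.regMass ξ ε x| ≤
      (supNorm ξ + K + 1) * (ε ^ n)⁻¹ * ε⁻¹ * (δ + ‖x - z‖) *
        V.mass.real (Metric.closedBall x (4 * ε)) := by
  have hs := supNorm_nonneg ξ
  have hε' : 1 ≤ ε⁻¹ := (one_le_inv₀ hε).2 hε1
  have hc : Continuous (scaledKernel n ξ ε) := by
    have := hξ.continuous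
    unfold scaledKernel
    fun_prop
  have e : ∀ (U : Varifold d n Ω) (v : E n), U.regMass ξ ε v =
      ∫ p, scaledKernel n ξ ε ((p.1 : E n) - v) ∂U.measure := fun U v => by
    rw [regMass, U.integral_mass (f := fun y => scaledKernel n ξ ε (v - y)) (by fun_prop)]
    simp only [scaledKernel_sub_comm ξ ε v]
  rw [e, e]
  -- No derivative falls on `ξ`, so the constant carries `ε^(-1)` instead of `ε^(-2)`; the summand
  -- `1` keeps it positive.
  refine V.abs_integral_sub_le W hε hxz hx hη hηε hδ hΔ (F := fun w _ => scaledKernel n ξ ε w)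
    (by positivity) (fun w w' P P' => ?_) (fun w _ => ?_) fun w _ hw => scaledKernel_eq_zero hξ hε hw
  · have h1 : |ξ ‖ε⁻¹ • w‖ - ξ ‖ε⁻¹ • w'‖| ≤ K * (ε⁻¹ * ‖w - w'‖) := by
      refine (hK.dist_le_mul _ _).trans ?_
      gcongr
      refine (abs_norm_sub_norm_le _ _).trans_eq ?_
      rw [← smul_sub, norm_smul, norm_inv, Real.norm_of_nonneg hε.le]
    simp only [scaledKernel]
    rw [← mul_sub, abs_mul, abs_of_pos (by positivity : 0 < (ε ^ n)⁻¹)]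
    calc _ ≤ (ε ^ n)⁻¹ * (K * (ε⁻¹ * ‖w - w'‖)) := by gcongr
      _ ≤ (ε ^ n)⁻¹ * ((supNorm ξ + K + 1) * (ε⁻¹ * max ‖w - w'‖ (dist P P'))) := by
        gcongr
        · linarith
        · exact le_max_left _ _
      _ = _ := by ring
  · simp only [scaledKernel]
    rw [abs_mul, abs_of_pos (by positivity : 0 < (ε ^ n)⁻¹)]
    calc _ ≤ (ε ^ n)⁻¹ * (supNorm ξ + K + 1) := by
          gcongr
          have := abs_le_supNorm hξ.continuous hξ.hasCompactSupport ‖ε⁻¹ • w‖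
          linarith [K.2]
      _ ≤ (ε ^ n)⁻¹ * (supNorm ξ + K + 1) * ε⁻¹ := le_mul_of_one_le_right (by positivity) hε'
      _ = _ := by ring

/-- The identity `a/b - a'/b' = (a - a')/b + ((b' - b)/b)(a'/b')` makes the denominator error
multiply the reference quotient, which stays bounded because it converges. -/
lemma norm_quotient_sub_le {F : Type*} [NormedAddCommGroup F] [NormedSpace ℝ F] {a a' : F}
    {b b' b₀ c p q h : ℝ} (hc : 0 ≤ c) (hb₀ : 0 < b₀) (hb : b₀ ≤ b) (hb' : 0 < b')
    (h1 : ‖a - a'‖ ≤ p) (h2 : |b - b'| ≤ q) (h3 : ‖c • (b'⁻¹ • a')‖ ≤ h) :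
    ‖c • (b⁻¹ • a) - c • (b'⁻¹ • a')‖ ≤ c * p / b₀ + h * q / b₀ := by
  have hbpos : 0 < b := hb₀.trans_le hb
  have hq : 0 ≤ q := (abs_nonneg _).trans h2
  have hh : 0 ≤ h := (norm_nonneg _).trans h3
  have hinv : b⁻¹ ≤ b₀⁻¹ := inv_anti₀ hb₀ hb
  have e : c • (b⁻¹ • a) - c • (b'⁻¹ • a') =
      (c * b⁻¹) • (a - a') + (b⁻¹ * (b' - b)) • (c • (b'⁻¹ • a')) := by
    have : (b⁻¹ * (b' - b)) • (c • (b'⁻¹ • a')) = (c * b⁻¹ - c * b'⁻¹) • a' := by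
      rw [smul_smul, smul_smul]
      congr 1
      field_simp
    rw [this, smul_sub, sub_smul, smul_smul, smul_smul]
    abel
  rw [e]
  refine (norm_add_le _ _).trans (add_le_add ?_ ?_)
  · rw [norm_smul, Real.norm_of_nonneg (by positivity)]
    calc c * b⁻¹ * ‖a - a'‖ ≤ c * b₀⁻¹ * p := by gcongr
      _ = _ := by ring
  · rw [norm_smul, norm_mul, Real.norm_of_nonneg (by positivity : 0 ≤ b⁻¹), Real.norm_eq_abs,
      abs_sub_comm]
    calc b⁻¹ * |b - b'| * ‖c • (b'⁻¹ • a')‖ ≤ b₀⁻¹ * q * h := by gcongr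
      _ = _ := by ring

/-- Stability of the approximate mean curvature at a blow-up point at which the approximate mean
curvatures of `V` converge. -/
lemma Varifold.eventually_norm_approxMeanCurvature_sub_le (V : Varifold d n Ω) (hΩ : IsOpen Ω)
    (hd : 1 ≤ d) (hdn : d < n) {ρ ξ : ℝ → ℝ} (hk : IsRegularKernelPair n ρ ξ) {x : E n}
    (hx : x ∈ Ω) {θ : ℝ} (hθ : 0 < θ) (hb : HasRadialBlowup V.mass d x θ) {h : E n}
    (hlim : Tendsto (fun r => V.approxMeanCurvature ρ ξ r x) (𝓝[>] 0) (𝓝 h))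
    {W : ℕ → Varifold d n Ω} {η δ : ℕ → ℝ} (hη : ∀ i, 0 < η i) (hδ : ∀ i, 0 < δ i)
    (hΔ : ∀ i, ∀ r : ℝ, 0 < r → Metric.ball x r ⊆ Ω → bddLipDist (Metric.ball x r) V (W i) ≤
      ENNReal.ofReal (δ i) * V.mass (Metric.thickening (η i) (Metric.ball x r)))
    {z : ℕ → E n} {ε : ℕ → ℝ} (hε : Tendsto ε atTop (𝓝[>] 0))
    (hτ : Tendsto (fun i => (δ i + ‖x - z i‖) / ε i ^ 2) atTop (𝓝 0))
    (hηε : Tendsto (fun i => η i / ε i) atTop (𝓝 0)) :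
    ∀ᶠ i in atTop, 0 < V.regMass ξ (ε i) x ∧ 0 < (W i).regMass ξ (ε i) (z i) ∧
      ‖(W i).approxMeanCurvature ρ ξ (ε i) (z i) - V.approxMeanCurvature ρ ξ (ε i) x‖ ≤
        (16 * (cutoffIntegral d + 1) / kernelLowerBound d n + 1) * normW2 ρ *
          ((δ i + ‖x - z i‖) / ε i ^ 2) := by
  obtain ⟨K, hK⟩ := hk.lipschitz_right
  have hN := normW2_pos hk.profile_left
  have hA := cutoffIntegral_nonneg d
  have hl := kernelLowerBound_pos hd hdn
  have hlρ := kernelLowerBound_le hk.profile_left hd hdn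
  have hρ0 := hk.profile_left.kernelConst_pos hd hdn
  have hξ0 := hk.profile_right.kernelConst_pos hd hdn
  have hξs := supNorm_nonneg ξ
  set A := cutoffIntegral d + 1 with hA'
  set Q := (supNorm ξ + K + 1) * (θ * A) with hQ
  have hA0 : 0 < A := by positivity
  have hQ0 : 0 < Q := by positivity
  -- A quarter of the limiting denominator: the one for `V` eventually exceeds `2 b₀`, and the one
  -- for `W i` differs from it by less than `b₀`.
  set b₀ := θ * kernelConst d ξ / 4 with hb₀
  have hb₀pos : 0 < b₀ := by positivity
  have hε0 : Tendsto ε atTop (𝓝 0) := hε.mono_right nhdsWithin_le_nhds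
  have hmass := V.tendsto_regMass hd hb hk.profile_right
  have hlow : 2 * b₀ < θ * kernelConst d ξ := by
    rw [hb₀]
    linarith [mul_pos hθ hξ0]
  -- The surplus factor `ε` pushes this below `normW2 ρ`, which accounts for the summand `1` in the
  -- constant although `Q` and `h` depend on `ξ` and `x`.
  have hQε : Tendsto (fun i => (‖h‖ + 1) * Q / b₀ * ε i) atTop (𝓝 0) := by
    simpa using hε0.const_mul ((‖h‖ + 1) * Q / b₀)
  have hτε : Tendsto (fun i => Q * ((δ i + ‖x - z i‖) / ε i ^ 2 * ε i)) atTop (𝓝 0) := by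
    simpa using (hτ.mul hε0).const_mul Q
  filter_upwards [hε.eventually self_mem_nhdsWithin, hε0.eventually (gt_mem_nhds one_pos),
    hε.eventually (eventually_closedBall_subset hΩ hx (c := 4) (by norm_num)),
    hε.eventually (V.eventually_mass_closedBall_le hΩ hx hθ hb),
    hε.eventually (hmass.eventually (lt_mem_nhds hlow)),
    hε.eventually (hlim.norm.eventually (gt_mem_nhds (lt_add_one ‖h‖))),
    hτ.eventually (gt_mem_nhds one_pos), hηε.eventually (gt_mem_nhds one_pos),
    hQε.eventually (gt_mem_nhds hN), hτε.eventually (gt_mem_nhds hb₀pos)]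
    with i hi0 hi1 hiΩ hm hβ' hh hτi hηi hQi hτεi
  set e := ε i with he
  replace hi0 : 0 < e := hi0
  have hDδ := hδ i
  set D := δ i + ‖x - z i‖ with hD
  have hD0 : 0 < D := by positivity
  -- From `D < e²` and `e < 1`.
  have hxz : ‖x - z i‖ ≤ e := by
    rw [div_lt_one (by positivity)] at hτi
    nlinarith
  have hηe : η i ≤ e := by
    rw [div_lt_one hi0] at hηi
    exact hηi.le
  have hball : Metric.ball x (3 * e) ⊆ Ω :=
    (Metric.ball_subset_closedBall.trans (Metric.closedBall_subset_closedBall (by linarith))).trans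
      hiΩ
  have hΔi := hΔ i (3 * e) (by positivity) hball
  have h1 := V.norm_regFirstVariation_sub_le (W i) hi0 hi1.le hxz hiΩ (hη i) hηe hDδ.le hΔi hk
  have h2 := V.abs_regMass_sub_le (W i) hi0 hi1.le hxz hiΩ (hη i) hηe hDδ.le hΔi
    hk.profile_right hK
  set m := V.mass.real (Metric.closedBall x (4 * e))
  set s := e ^ n * (e ^ d)⁻¹ with hs
  have hs0 : 0 < s := by positivity
  set τ := D / e ^ 2 with hτ'
  have hτ0 : 0 < τ := by positivity
  have h1' : ‖s • (W i).regFirstVariation ρ e (z i) - s • V.regFirstVariation ρ e x‖ ≤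
      4 * normW2 ρ * (θ * A) * τ := by
    rw [← smul_sub, norm_smul, Real.norm_of_nonneg hs0.le]
    calc _ ≤ s * (4 * normW2 ρ * (e ^ n)⁻¹ * (e ^ 2)⁻¹ * D * (θ * A * e ^ d)) := by
          refine mul_le_mul_of_nonneg_left (h1.trans ?_) hs0.le
          exact mul_le_mul_of_nonneg_left hm (by positivity)
      _ = _ := by
          rw [hs, hτ']
          field_simp
  have h2' : |s * (W i).regMass ξ e (z i) - s * V.regMass ξ e x| ≤ Q * (τ * e) := by
    rw [← mul_sub, abs_mul, abs_of_pos hs0]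
    calc _ ≤ s * ((supNorm ξ + K + 1) * (e ^ n)⁻¹ * e⁻¹ * D * (θ * A * e ^ d)) := by
          refine mul_le_mul_of_nonneg_left (h2.trans ?_) hs0.le
          exact mul_le_mul_of_nonneg_left hm (by positivity)
      _ = _ := by
          rw [hs, hτ', hQ]
          field_simp
  have hβ'pos : 0 < s * V.regMass ξ e x := lt_trans (by positivity) hβ'
  have hβ : b₀ ≤ s * (W i).regMass ξ e (z i) := by
    have := neg_le_of_abs_le h2'
    linarith
  refine ⟨pos_of_mul_pos_right hβ'pos hs0.le, pos_of_mul_pos_right (hb₀pos.trans_le hβ) hs0.le, ?_⟩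
  rw [V.approxMeanCurvature_eq ρ ξ e x hs0.ne', norm_neg] at hh
  rw [V.approxMeanCurvature_eq ρ ξ e x hs0.ne', (W i).approxMeanCurvature_eq ρ ξ e _ hs0.ne',
    neg_sub_neg, norm_sub_rev]
  refine (norm_quotient_sub_le (by positivity) hb₀pos hβ hβ'pos h1' h2' hh.le).trans ?_
  -- Both `θ` and `C_ξ` cancel against `b₀`, and `16` is the kernel factor `4` times the `4` in
  -- `b₀`.
  have t1 : kernelConst d ξ / kernelConst d ρ * (4 * normW2 ρ * (θ * A) * τ) / b₀ =
      16 * A / kernelConst d ρ * (normW2 ρ * τ) := by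
    rw [hb₀]
    field_simp
    ring
  have t2 : (‖h‖ + 1) * (Q * (τ * e)) / b₀ = ((‖h‖ + 1) * Q / b₀ * e) * τ := by ring
  have t3 : 16 * A / kernelConst d ρ ≤ 16 * A / kernelLowerBound d n := by gcongr
  rw [t1, t2]
  calc _ ≤ 16 * A / kernelLowerBound d n * (normW2 ρ * τ) + normW2 ρ * τ := by gcongr
    _ = _ := by ring

end VarifoldCurvature
end
open VarifoldCurvature in
theorem theorem4p4 (d n : ℕ) (hd : 1 ≤ d) (hdn : d < n) :
    ∃ C : ℝ, 0 < C ∧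
    ∀ (ρ ξ : ℝ → ℝ), IsRegularKernelPair n ρ ξ →
    ∀ (Ω : Set (E n)), IsOpen Ω →
    ∀ (V : Varifold d n Ω), V.IsRectifiable → V.HasBoundedFirstVariation →
    ∀ (W : ℕ → Varifold d n Ω) (η δ : ℕ → ℝ),
      (∀ i, 0 < η i) → Antitone η → Tendsto η atTop (𝓝 0) →
      (∀ i, 0 < δ i) → Antitone δ → Tendsto δ atTop (𝓝 0) →
      (∀ i, ∀ a ∈ V.mass.support, ∀ r : ℝ, 0 < r → Metric.ball a r ⊆ Ω →
        bddLipDist (Metric.ball a r) V (W i) ≤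
          ENNReal.ofReal (δ i) *
            min (V.mass (Metric.thickening (η i) (Metric.ball a r)))
              ((W i).mass (Metric.thickening (η i) (Metric.ball a r)))) →
    ∀ᵐ x ∂V.mass, ∀ z : ℕ → E n, Tendsto z atTop (𝓝 x) →
      ∀ ε : ℕ → ℝ, (∀ i, 0 < ε i) → Antitone ε → Tendsto ε atTop (𝓝 0) →
        Tendsto (fun i => (δ i + ‖x - z i‖) / ε i ^ 2) atTop (𝓝 0) →
        Tendsto (fun i => η i / ε i) atTop (𝓝 0) →
        (∀ᶠ i in atTop, 0 < V.regMass ξ (ε i) x ∧ 0 < (W i).regMass ξ (ε i) (z i)) ∧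
        (∀ᶠ i in atTop,
          ‖(W i).approxMeanCurvature ρ ξ (ε i) (z i) - V.approxMeanCurvature ρ ξ (ε i) x‖ ≤
            C * normW2 ρ * ((δ i + ‖x - z i‖) / ε i ^ 2)) ∧
        Tendsto (fun i => (W i).approxMeanCurvature ρ ξ (ε i) (z i)) atTop
          (𝓝 (V.meanCurvature x)) := by
  refine ⟨16 * (cutoffIntegral d + 1) / kernelLowerBound d n + 1, ?_, ?_⟩
  · have := cutoffIntegral_nonneg d
    have := kernelLowerBound_pos hd hdn
    positivity
  intro ρ ξ hk Ω hΩ V hV hδV W η δ hη _ _ hδ _ _ hΔ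
  filter_upwards [V.ae_tendsto_approxMeanCurvature hΩ hd hdn hV hδV hk]
    with x ⟨hx, θ, hθ, hb, hlim⟩ z _ ε hε _ hε0 hτ hηε
  have hε' : Tendsto ε atTop (𝓝[>] 0) :=
    tendsto_nhdsWithin_iff.2 ⟨hε0, .of_forall hε⟩
  -- The distance hypothesis covers only balls centered in the support; positive mass of arbitrarily
  -- small balls puts `x` there.
  have hsupp : x ∈ V.mass.support := by
    rw [Measure.mem_support_iff_forall]
    intro U hU
    obtain ⟨R, hR, hRU⟩ := Metric.nhds_basis_closedBall.mem_iff.1 hU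
    obtain ⟨r, hr1, hr2⟩ := ((V.eventually_mass_closedBall_pos hΩ hd hdn hx hθ hb
      hk.profile_left).and (Ioo_mem_nhdsGT hR)).exists
    exact (ENNReal.toReal_pos_iff.1 hr1).1.trans_le
      (measure_mono ((Metric.closedBall_subset_closedBall hr2.2.le).trans hRU))
  have hmain := V.eventually_norm_approxMeanCurvature_sub_le hΩ hd hdn hk hx hθ hb hlim hη hδ
    (fun i r hr hrΩ => (hΔ i x hsupp r hr hrΩ).trans (by gcongr; exact min_le_left _ _))
    hε' hτ hηε
  refine ⟨hmain.mono fun i hi => ⟨hi.1, hi.2.1⟩, hmain.mono fun i hi => hi.2.2, ?_⟩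
  have h0 : Tendsto (fun i => (W i).approxMeanCurvature ρ ξ (ε i) (z i) -
      V.approxMeanCurvature ρ ξ (ε i) x) atTop (𝓝 0) := by
    refine squeeze_zero_norm' (hmain.mono fun i hi => hi.2.2) ?_
    simpa using hτ.const_mul ((16 * (cutoffIntegral d + 1) / kernelLowerBound d n + 1) * normW2 ρ)
  simpa using h0.add (hlim.comp hε')
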